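/- Let $\Bbbk$ be a field of arbitrary characteristic. An algebra is a $\Bbbk$-linear space with one bilinear multiplication (not necessarily associative or unital), and a multilinear variety $\mathrm{Var}$ is the class of all algebras satisfying a given set of multilinear identities. For a finite set $I$, let $\mathrm{Var}(I)$ be the space of multilinear nonassociative polynomials in the variables $I$ (every variable occurs exactly once in every monomial) modulo the identities that hold on $\mathrm{Var}$. With renaming of variables and substitution, these spaces form the symmetric operad of $\mathrm{Var}$, denoted by the same symbol; $\mathrm{Var}(n)$ is $\mathrm{Var}(I)$ for $I=\{1,\dots,n\}$. Let $\mathrm{Nov}$ be the variety of Novikov algebras, defined by $$(a\circ b)\circ c-a\circ(b\circ c)=(b\circ a)\circ c-b\circ(a\circ c),\qquad (a\circ b)\circ c=(a\circ c)\circ b.$$ The Manin white product $\mathrm{Var}\circ\mathrm{Nov}$ is the sub-operad of the Hadamard product $(\mathrm{Var}(n)\otimes\mathrm{Nov}(n))_n$ generated by $\mathrm{Var}(2)\otimes\mathrm{Nov}(2)$. Every algebra over the operad $\mathrm{Var}\circ\mathrm{Nov}$ has two bilinear operations given by the elements $$x_1\prec x_2=x_1x_2\otimes (x_1\circ x_2),\qquad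 x_1\succ x_2=x_1x_2\otimes (x_2\circ x_1).$$ For an algebra $A$ with a derivation $d$, let $A^{(d)}$ be the space $A$ with the operations $a\prec b=a\,d(b)$ and $a\succ b=d(a)\,b$. A nonassociative polynomial $f$ in the operations $\prec,\succ$ is a derived identity of $\mathrm{Var}$ if $f=0$ holds on $A^{(d)}$ for every $A\in\mathrm{Var}$ and every derivation $d$ of $A$. Let $D\mathrm{Var}$ be the operad defined by the derived identities, that is, the operad formed by the spaces of multilinear polynomials in $\prec,\succ$ modulo derived identities. Theorem. Let $\mathrm{Var}$ be a multilinear variety of algebras. (1) A multilinear polynomial $f(x_1,\dots,x_n)$ in the operations $\prec,\succ$ is an identity on all algebras over the operad $\mathrm{Var}\circ\mathrm{Nov}$ if and only if $f$ is a derived identity of $\mathrm{Var}$. (2) $D\mathrm{Var}=\mathrm{Var}\circ\mathrm{Nov}$: there is an isomorphism of operads $D\mathrm{Var}\to\mathrm{Var}\circ\mathrm{Nov}$ which sends $x_1\prec x_2$ to $x_1x_2\otimes(x_1\circ x_2)$ and $x_1\succ x_2$ to $x_1x_2\otimes(x_2\circ x_1)$. -/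

import Mathlib

open scoped TensorProduct

universe u

/-! ### Nonassociative polynomials in a set `Ω` of binary operations -/

/-- Nonassociative monomials in the variables `X` and the binary operations `Ω`. -/
inductive Mon (Ω X : Type) : Type
  | var (x : X) : Mon Ω X
  | mul (ω : Ω) (l r : Mon Ω X) : Mon Ω X

/-- A family of bilinear operations, indexed by `Ω`, on a linear space `A`. -/
abbrev BilinOps (K : Type u) [Field K] (Ω : Type) (A : Type u) [AddCommGroup A] [Module K A] :
    Type u :=
  Ω → A →ₗ[K] A →ₗ[K] A

namespace Mon

variable {Ω X Y : Type}

/-- The variables of a monomial from left to right, with repetitions. -/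
def letters : Mon Ω X → List X
  | var x => [x]
  | mul _ l r => l.letters ++ r.letters

/-- Every variable in `X` occurs in the monomial exactly once. -/
def IsMultilinear (w : Mon Ω X) : Prop := w.letters.Nodup ∧ ∀ x, x ∈ w.letters

/-- Substitution of monomials for the variables. -/
def bind (φ : X → Mon Ω Y) : Mon Ω X → Mon Ω Y
  | var x => φ x
  | mul ω l r => mul ω (l.bind φ) (r.bind φ)

/-- The value of a monomial in an algebra. -/
def eval {K : Type u} [Field K] {A : Type u} [AddCommGroup A] [Module K A]
    (m : BilinOps K Ω A) (a : X → A) : Mon Ω X → A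
  | var x => a x
  | mul ω l r => m ω (l.eval m a) (r.eval m a)

theorem letters_bind (φ : X → Mon Ω Y) (w : Mon Ω X) :
    (w.bind φ).letters = w.letters.flatMap (fun x => (φ x).letters) := by
  induction w with
  | var x => simp [bind, letters]
  | mul ω l r hl hr => simp [bind, letters, hl, hr]

section eval

variable {K : Type u} [Field K] {A : Type u} [AddCommGroup A] [Module K A]

theorem eval_bind (m : BilinOps K Ω A) (a : Y → A) (φ : X → Mon Ω Y) (w : Mon Ω X) :
    (w.bind φ).eval m a = w.eval m (fun x => (φ x).eval m a) := by
  induction w with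
  | var x => rfl
  | mul ω l r hl hr => simp [bind, eval, hl, hr]

theorem eval_congr (m : BilinOps K Ω A) {a b : X → A} (w : Mon Ω X)
    (h : ∀ x ∈ w.letters, a x = b x) : w.eval m a = w.eval m b := by
  induction w with
  | var x => exact h x (by simp [letters])
  | mul ω l r hl hr =>
    simp only [eval]
    rw [hl (fun x hx => h x (by simp [letters, hx])), hr (fun x hx => h x (by simp [letters, hx]))]

/-- A monomial in which the variable `none` occurs once is linear in it. -/
theorem eval_linear (m : BilinOps K Ω A) (a : X → A) (w : Mon Ω (Option X))
    (hn : w.letters.Nodup) (hw : none ∈ w.letters) (s : K) (b c : A) :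
    w.eval m (fun o => o.elim (s • b + c) a) =
      s • w.eval m (fun o => o.elim b a) + w.eval m (fun o => o.elim c a) := by
  induction w with
  | var x =>
    simp only [letters, List.mem_singleton] at hw
    subst hw
    simp [eval]
  | mul ω l r hl hr =>
    simp only [letters, List.nodup_append] at hn
    obtain ⟨hnl, hnr, hd⟩ := hn
    have key : ∀ (v : Mon Ω (Option X)), none ∉ v.letters → ∀ b c : A,
        v.eval m (fun o => o.elim b a) = v.eval m (fun o => o.elim c a) := by
      intro v hv b c
      refine eval_congr m v fun x hx => ?_
      cases x with
      | none => exact absurd hx hv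
      | some x => rfl
    simp only [letters, List.mem_append] at hw
    simp only [eval]
    by_cases h : none ∈ l.letters
    · have h' : none ∉ r.letters := fun h2 => hd _ h _ h2 rfl
      rw [hl hnl h, key r h' (s • b + c) c, key r h' b c]
      simp
    · have h' : none ∈ r.letters := hw.resolve_left h
      rw [hr hnr h', key l h (s • b + c) c, key l h b c]
      simp

end eval

end Mon

/-- Nonassociative polynomials: the free algebra with operations `Ω` generated by `X`. -/
abbrev NAPoly (K : Type u) [Field K] (Ω X : Type) : Type u := Mon Ω X →₀ K

namespace NAPoly

variable {K : Type u} [Field K] {Ω X Y : Type}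

/-- A monomial as a polynomial. -/
noncomputable def mon (w : Mon Ω X) : NAPoly K Ω X := Finsupp.single w 1

/-- The operations of the free algebra. -/
noncomputable def ops : BilinOps K Ω (NAPoly K Ω X) := fun ω =>
  Finsupp.linearCombination K fun l => Finsupp.lmapDomain K K (Mon.mul ω l)

theorem ops_mon (ω : Ω) (l r : Mon Ω X) :
    ops ω (mon l : NAPoly K Ω X) (mon r) = mon (Mon.mul ω l r) := by
  simp [ops, mon]

/-- The value of a polynomial in an algebra. -/
noncomputable def eval {A : Type u} [AddCommGroup A] [Module K A]
    (m : BilinOps K Ω A) (a : X → A) : NAPoly K Ω X →ₗ[K] A :=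
  Finsupp.linearCombination K (Mon.eval m a)

/-- The space of multilinear polynomials: every variable in `X` occurs exactly once in
every monomial. -/
noncomputable def multilinear (K : Type u) [Field K] (Ω X : Type) : Submodule K (NAPoly K Ω X) :=
  Submodule.span K (mon '' {w : Mon Ω X | w.IsMultilinear})

section

variable {A B : Type u} [AddCommGroup A] [Module K A] [AddCommGroup B] [Module K B]

@[simp] theorem eval_mon (m : BilinOps K Ω A) (a : X → A) (w : Mon Ω X) :
    eval m a (mon w) = w.eval m a := by
  simp [eval, mon]

theorem hom_ext {f g : NAPoly K Ω X →ₗ[K] A} (h : ∀ w, f (mon w) = g (mon w)) : f = g := by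
  refine Finsupp.lhom_ext' fun w => LinearMap.ext_ring ?_
  exact h w

theorem eval_ops (m : BilinOps K Ω A) (a : X → A) (ω : Ω) (f g : NAPoly K Ω X) :
    eval m a (ops ω f g) = m ω (eval m a f) (eval m a g) := by
  have h : (ops ω).compr₂ (eval m a) = (m ω).compl₁₂ (eval m a) (eval m a) := by
    refine hom_ext fun l => hom_ext fun r => ?_
    simp only [LinearMap.compr₂_apply, LinearMap.compl₁₂_apply, ops_mon, eval_mon]
    rfl
  exact LinearMap.congr_fun₂ h f g

/-- Homomorphisms commute with evaluation. -/
theorem map_eval (m : BilinOps K Ω A) (m' : BilinOps K Ω B) (F : A →ₗ[K] B)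
    (hF : ∀ ω x y, F (m ω x y) = m' ω (F x) (F y)) (a : X → A) (f : NAPoly K Ω X) :
    F (eval m a f) = eval m' (fun x => F (a x)) f := by
  have h : F ∘ₗ eval m a = eval m' (fun x => F (a x)) := by
    refine hom_ext fun w => ?_
    simp only [LinearMap.comp_apply, eval_mon]
    induction w with
    | var x => rfl
    | mul ω l r hl hr => simp only [Mon.eval, hF, hl, hr]
  exact LinearMap.congr_fun h f

end

end NAPoly

/-! ### Classes of algebras, their identities and free algebras -/

/-- A class of algebras with operations `Ω`. -/
abbrev AlgClass (K : Type u) [Field K] (Ω : Type) : Type (u + 1) :=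
  ∀ (A : Type u) [AddCommGroup A] [Module K A], BilinOps K Ω A → Prop

namespace AlgClass

variable {K : Type u} [Field K] {Ω : Type}

/-- The T-ideal of all identities in the variables `X` that hold on the class. -/
noncomputable def identities (C : AlgClass K Ω) (X : Type) : Submodule K (NAPoly K Ω X) where
  carrier := {f | ∀ (A : Type u) [AddCommGroup A] [Module K A] (m : BilinOps K Ω A),
    C A m → ∀ a : X → A, NAPoly.eval m a f = 0}
  add_mem' := by
    intro f g hf hg A _ _ m hm a
    simp [hf A m hm a, hg A m hm a]
  zero_mem' := by
    intro A _ _ m hm a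
    simp
  smul_mem' := by
    intro c f hf A _ _ m hm a
    simp [hf A m hm a]

/-- The free algebra generated by `X` in the variety generated by the class. -/
abbrev Free (C : AlgClass K Ω) (X : Type) : Type u := NAPoly K Ω X ⧸ C.identities X

variable (C : AlgClass K Ω) {X Y Z : Type}

theorem ops_mem_left (ω : Ω) {f : NAPoly K Ω X} (hf : f ∈ C.identities X) (g : NAPoly K Ω X) :
    NAPoly.ops ω f g ∈ C.identities X := by
  intro A _ _ m hm a
  rw [NAPoly.eval_ops, hf A m hm a]
  simp

theorem ops_mem_right (ω : Ω) (f : NAPoly K Ω X) {g : NAPoly K Ω X} (hg : g ∈ C.identities X) :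
    NAPoly.ops ω f g ∈ C.identities X := by
  intro A _ _ m hm a
  rw [NAPoly.eval_ops, hg A m hm a]
  simp

/-- The operations of the free algebra, induced from those on polynomials. -/
noncomputable def freeOps : BilinOps K Ω (C.Free X) := fun ω =>
  ((C.identities X).liftQ
    ((C.identities X).liftQ ((NAPoly.ops ω).compr₂ (C.identities X).mkQ) (by
      intro f hf
      refine LinearMap.mem_ker.2 (LinearMap.ext fun g => ?_)
      simpa using C.ops_mem_left ω hf g)).flip (by
    intro g hg
    refine LinearMap.mem_ker.2 (LinearMap.ext fun f => ?_)
    obtain ⟨f, rfl⟩ := (C.identities X).mkQ_surjective f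
    simpa using C.ops_mem_right ω f hg)).flip

theorem freeOps_mk (ω : Ω) (f g : NAPoly K Ω X) :
    C.freeOps ω ((C.identities X).mkQ f) ((C.identities X).mkQ g)
      = (C.identities X).mkQ (NAPoly.ops ω f g) := rfl

/-- Substitution of elements of the free algebra generated by `Y` for the variables `X`. -/
noncomputable def subst (φ : X → C.Free Y) : C.Free X →ₗ[K] C.Free Y :=
  (C.identities X).liftQ (NAPoly.eval C.freeOps φ) (by
    intro f hf
    rw [LinearMap.mem_ker]
    obtain ⟨ψ, rfl⟩ : ∃ ψ : X → NAPoly K Ω Y, φ = fun x => (C.identities Y).mkQ (ψ x) :=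
      ⟨fun x => ((C.identities Y).mkQ_surjective (φ x)).choose,
        funext fun x => ((C.identities Y).mkQ_surjective (φ x)).choose_spec.symm⟩
    rw [← NAPoly.map_eval NAPoly.ops C.freeOps (C.identities Y).mkQ
      (fun ω x y => (C.freeOps_mk ω x y).symm)]
    simp only [Submodule.mkQ_apply, Submodule.Quotient.mk_eq_zero]
    intro A _ _ m hm a
    rw [NAPoly.map_eval NAPoly.ops m (NAPoly.eval m a) (NAPoly.eval_ops m a)]
    exact hf A m hm _)

/-- The class of a monomial in the free algebra. -/
noncomputable def mk (w : Mon Ω X) : C.Free X := (C.identities X).mkQ (NAPoly.mon w)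

/-- The generators of the free algebra. -/
noncomputable def gen (x : X) : C.Free X := C.mk (Mon.var x)

theorem free_ext {A : Type u} [AddCommGroup A] [Module K A] {f g : C.Free X →ₗ[K] A}
    (h : ∀ w, f (C.mk w) = g (C.mk w)) : f = g := by
  refine Submodule.linearMap_qext _ (NAPoly.hom_ext h)

@[simp] theorem subst_mk (φ : X → C.Free Y) (w : Mon Ω X) :
    C.subst φ (C.mk w) = w.eval C.freeOps φ := by
  simp [subst, mk]

@[simp] theorem subst_gen (φ : X → C.Free Y) (x : X) : C.subst φ (C.gen x) = φ x := by
  simp [gen, Mon.eval]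

theorem eval_mk (φ : X → Mon Ω Y) (w : Mon Ω X) :
    w.eval C.freeOps (fun x => C.mk (φ x)) = C.mk (w.bind φ) := by
  induction w with
  | var x => rfl
  | mul ω l r hl hr =>
    rw [Mon.eval, hl, hr]
    simp only [Mon.bind, mk, freeOps_mk, NAPoly.ops_mon]

theorem subst_freeOps (φ : X → C.Free Y) (ω : Ω) (f g : C.Free X) :
    C.subst φ (C.freeOps ω f g) = C.freeOps ω (C.subst φ f) (C.subst φ g) := by
  obtain ⟨f, rfl⟩ := (C.identities X).mkQ_surjective f
  obtain ⟨g, rfl⟩ := (C.identities X).mkQ_surjective g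
  rw [freeOps_mk]
  simp only [subst, Submodule.mkQ_apply, Submodule.liftQ_apply]
  exact NAPoly.eval_ops _ _ _ _ _

theorem subst_subst (φ : X → C.Free Y) (ψ : Y → C.Free Z) (f : C.Free X) :
    C.subst ψ (C.subst φ f) = C.subst (fun x => C.subst ψ (φ x)) f := by
  have h : C.subst ψ ∘ₗ C.subst φ = C.subst (fun x => C.subst ψ (φ x)) := by
    refine C.free_ext fun w => ?_
    simp only [LinearMap.comp_apply, subst_mk]
    induction w with
    | var x => rfl
    | mul ω l r hl hr => simp only [Mon.eval, subst_freeOps, hl, hr]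
  exact LinearMap.congr_fun h f

theorem subst_id (f : C.Free X) : C.subst C.gen f = f := by
  have h : C.subst (C.gen (X := X)) = LinearMap.id := by
    refine C.free_ext fun w => ?_
    have e : w.bind Mon.var = w := by
      induction w with
      | var x => rfl
      | mul ω l r hl hr => simp [Mon.bind, hl, hr]
    rw [subst_mk]
    exact (C.eval_mk Mon.var w).trans (by rw [e]; rfl)
  exact LinearMap.congr_fun h f

/-- The multilinear part of the free algebra: the image of the multilinear polynomials. -/
noncomputable def multilinearPart (X : Type) : Submodule K (C.Free X) :=
  (NAPoly.multilinear K Ω X).map (C.identities X).mkQ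

theorem multilinearPart_eq_span :
    C.multilinearPart X = Submodule.span K (C.mk '' {w : Mon Ω X | w.IsMultilinear}) := by
  rw [multilinearPart, NAPoly.multilinear, Submodule.map_span, Set.image_image]
  rfl

theorem mk_mem {w : Mon Ω X} (hw : w.IsMultilinear) : C.mk w ∈ C.multilinearPart X := by
  rw [multilinearPart_eq_span]
  exact Submodule.subset_span ⟨w, hw, rfl⟩

theorem multilinear_induction {p : C.Free X → Prop}
    (hm : ∀ w : Mon Ω X, w.IsMultilinear → p (C.mk w)) (h0 : p 0)
    (ha : ∀ f g, p f → p g → p (f + g)) (hs : ∀ (c : K) f, p f → p (c • f))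
    {f : C.Free X} (hf : f ∈ C.multilinearPart X) : p f := by
  rw [multilinearPart_eq_span] at hf
  induction hf using Submodule.span_induction with
  | mem x hx => obtain ⟨w, hw, rfl⟩ := hx; exact hm w hw
  | zero => exact h0
  | add x y _ _ hx hy => exact ha x y hx hy
  | smul c x _ hx => exact hs c x hx

/-- Renaming of the variables. -/
noncomputable def rename (e : X → Y) : C.Free X →ₗ[K] C.Free Y := C.subst fun x => C.gen (e x)

theorem rename_mem (e : X ≃ Y) {f : C.Free X} (hf : f ∈ C.multilinearPart X) :
    C.rename e f ∈ C.multilinearPart Y := by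
  refine C.multilinear_induction (p := fun f => C.rename e f ∈ C.multilinearPart Y)
    ?_ ?_ ?_ ?_ hf
  · intro w hw
    have : C.rename e (C.mk w) = C.mk (w.bind fun x => Mon.var (e x)) := by
      rw [rename, subst_mk]
      exact C.eval_mk _ w
    rw [this]
    refine C.mk_mem ⟨?_, ?_⟩
    · rw [Mon.letters_bind]
      simpa only [Mon.letters, List.map_eq_flatMap] using hw.1.map e.injective
    · intro y
      rw [Mon.letters_bind]
      simp only [Mon.letters, List.mem_flatMap, List.mem_singleton]
      exact ⟨e.symm y, hw.2 _, by simp⟩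
  · simp
  · intro f g hf hg
    simpa using add_mem hf hg
  · intro c f hf
    simpa using Submodule.smul_mem _ c hf

/-- Substitution of `g` for the variable `none` in `f`, the variables of `f` and of `g` being
kept disjoint. -/
noncomputable def insert (f : C.Free (Option X)) (g : C.Free Y) : C.Free (X ⊕ Y) :=
  C.subst (fun o => o.elim (C.rename Sum.inr g) fun x => C.gen (Sum.inl x)) f

theorem insert_linear_right {f : C.Free (Option X)} (hf : f ∈ C.multilinearPart (Option X))
    (c : K) (g h : C.Free Y) : C.insert f (c • g + h) = c • C.insert f g + C.insert f h := by
  refine C.multilinear_induction (p := fun f => C.insert f (c • g + h) =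
    c • C.insert f g + C.insert f h) ?_ ?_ ?_ ?_ hf
  · intro w hw
    simp only [insert, map_add, map_smul, subst_mk]
    exact Mon.eval_linear _ _ w hw.1 (hw.2 _) _ _ _
  · simp [insert]
  · intro f f' hf hf'
    simp only [insert, map_add] at hf hf' ⊢
    rw [hf, hf', smul_add]
    abel
  · intro s f hf
    simp only [insert, map_smul] at hf ⊢
    rw [hf, smul_add, smul_comm]

theorem insert_mem {f : C.Free (Option X)} (hf : f ∈ C.multilinearPart (Option X))
    {g : C.Free Y} (hg : g ∈ C.multilinearPart Y) :
    C.insert f g ∈ C.multilinearPart (X ⊕ Y) := by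
  refine C.multilinear_induction (p := fun f => C.insert f g ∈ C.multilinearPart (X ⊕ Y))
    ?_ ?_ ?_ ?_ hf
  · intro w hw
    have hl := fun (c : K) (g h : C.Free Y) => C.insert_linear_right (C.mk_mem hw) c g h
    refine C.multilinear_induction
      (p := fun g => C.insert (C.mk w) g ∈ C.multilinearPart (X ⊕ Y)) ?_ ?_ ?_ ?_ hg
    · intro v hv
      let φ : Option X → Mon Ω (X ⊕ Y) := fun o =>
        o.elim (v.bind fun y => Mon.var (Sum.inr y)) fun x => Mon.var (Sum.inl x)
      have hv1 : (v.bind fun y => (Mon.var (Sum.inr y) : Mon Ω (X ⊕ Y))).letters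
          = v.letters.map Sum.inr := by
        rw [Mon.letters_bind, List.map_eq_flatMap]
        rfl
      have : C.insert (C.mk w) (C.mk v) = C.mk (w.bind φ) := by
        rw [insert, subst_mk, ← eval_mk]
        congr 1
        funext o
        cases o with
        | none =>
          simp only [Option.elim, rename, subst_mk, φ]
          exact C.eval_mk (fun y => Mon.var (Sum.inr y)) v
        | some x => rfl
      rw [this]
      refine C.mk_mem ⟨?_, ?_⟩
      · rw [Mon.letters_bind, List.nodup_flatMap]
        refine ⟨?_, ?_⟩
        · intro o _
          cases o with
          | none =>
            simp only [φ, Option.elim, hv1]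
            exact hv.1.map Sum.inr_injective
          | some x => simp [φ, Mon.letters]
        · refine hw.1.imp ?_
          intro a b hab
          cases a <;> cases b
          · exact absurd rfl hab
          · simp [φ, Mon.letters, Function.onFun, hv1]
          · simp [φ, Mon.letters, Function.onFun, hv1]
          · simpa [φ, Mon.letters, Function.onFun, eq_comm] using hab
      · intro z
        rw [Mon.letters_bind, List.mem_flatMap]
        cases z with
        | inl x => exact ⟨some x, hw.2 _, by simp [φ, Mon.letters]⟩
        | inr y => exact ⟨none, hw.2 _, by simp [φ, hv1, hv.2]⟩
    · have := hl 0 0 0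
      simp only [smul_zero, add_zero, zero_smul, zero_add] at this
      have h1 := hl 1 0 0
      simp only [smul_zero, add_zero, one_smul] at h1
      have h0 : C.insert (C.mk w) (0 : C.Free Y) = 0 := by
        simpa using h1
      rw [h0]
      exact zero_mem _
    · intro g h hg hh
      have := hl 1 g h
      simp only [one_smul] at this
      rw [this]
      exact add_mem hg hh
    · intro c g hg
      have h1 := hl 1 0 0
      simp only [smul_zero, add_zero, one_smul] at h1
      have h0 : C.insert (C.mk w) (0 : C.Free Y) = 0 := by
        simpa using h1
      have := hl c g 0
      simp only [add_zero, h0] at this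
      rw [this]
      exact Submodule.smul_mem _ _ hg
  · simp [insert]
  · intro f f' hf hf'
    simp only [insert, map_add] at hf hf' ⊢
    exact add_mem hf hf'
  · intro s f hf
    simp only [insert, map_smul] at hf ⊢
    exact Submodule.smul_mem _ _ hf

/-- `AlgClass.insert` as a bilinear map on multilinear elements. -/
noncomputable def insertLinear (X Y : Type) : C.multilinearPart (Option X) →ₗ[K]
    C.multilinearPart Y →ₗ[K] C.multilinearPart (X ⊕ Y) :=
  LinearMap.mk₂ K (fun f g => ⟨C.insert f.1 g.1, C.insert_mem f.2 g.2⟩)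
    (fun f f' g => Subtype.ext (map_add (C.subst _) f.1 f'.1))
    (fun c f g => Subtype.ext (map_smul (C.subst _) c f.1))
    (fun f g g' => Subtype.ext (by
      have h := C.insert_linear_right f.2 1 g.1 g'.1
      rw [one_smul, one_smul] at h
      exact h))
    (fun c f g => Subtype.ext (by
      have h0 := C.insert_linear_right f.2 1 (0 : C.Free Y) 0
      rw [one_smul, one_smul, add_zero, left_eq_add] at h0
      have h := C.insert_linear_right f.2 c g.1 0
      rw [h0, add_zero, add_zero] at h
      exact h))

end AlgClass

/-! ### Symmetric operads -/

/-- `(I ⊔ {∗}) ⊔ J ≃ (I ⊔ J) ⊔ {∗}`. -/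
def optionSum (I J : Type) : Option I ⊕ J ≃ Option (I ⊕ J) where
  toFun := Sum.elim (fun o => o.map Sum.inl) fun j => some (Sum.inr j)
  invFun o := o.elim (Sum.inl none) (Sum.elim (fun i => Sum.inl (some i)) Sum.inr)
  left_inv := by rintro ((_ | i) | j) <;> rfl
  right_inv := by rintro (_ | (i | j)) <;> rfl

/-- `I ⊔ (J ⊔ {∗}) ≃ (I ⊔ J) ⊔ {∗}`. -/
def sumOption (I J : Type) : I ⊕ Option J ≃ Option (I ⊕ J) where
  toFun := Sum.elim (fun i => some (Sum.inl i)) fun o => o.map Sum.inr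
  invFun o := o.elim (Sum.inr none) (Sum.elim Sum.inl fun j => Sum.inr (some j))
  left_inv := by rintro (i | (_ | j)) <;> rfl
  right_inv := by rintro (_ | (i | j)) <;> rfl

/-- The transposition of the two added points of `(I ⊔ {∗}) ⊔ {∗}`. -/
def optionSwap (I : Type) : Option (Option I) ≃ Option (Option I) where
  toFun o := o.elim (some none) fun o' => o'.elim none fun i => some (some i)
  invFun o := o.elim (some none) fun o' => o'.elim none fun i => some (some i)
  left_inv := by rintro (_ | _ | i) <;> rfl
  right_inv := by rintro (_ | _ | i) <;> rfl

/-- `(I ⊔ L) ⊔ J ≃ (I ⊔ J) ⊔ L`. -/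
def sumRightSwap (I J L : Type) : (I ⊕ L) ⊕ J ≃ (I ⊕ J) ⊕ L where
  toFun := Sum.elim (Sum.elim (fun i => Sum.inl (Sum.inl i)) Sum.inr) fun j => Sum.inl (Sum.inr j)
  invFun := Sum.elim (Sum.elim (fun i => Sum.inl (Sum.inl i)) Sum.inr) fun l => Sum.inl (Sum.inr l)
  left_inv := by rintro ((i | l) | j) <;> rfl
  right_inv := by rintro ((i | j) | l) <;> rfl

/-- A symmetric `K`-linear operad, with operations whose inputs are labelled by the elements of
an arbitrary finite set (`P(n)` is `Op (Fin n)`, with the action of the symmetric group given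
by `map`), presented by partial compositions: `comp p q` inserts `q` into the input
`none` of `p`. Other inputs are brought to this position by `map`. -/
structure SymOperad (K : Type u) [Field K] where
  Op : (I : Type) → [Finite I] → Type u
  [addCommGroup : ∀ (I : Type) [Finite I], AddCommGroup (Op I)]
  [module : ∀ (I : Type) [Finite I], Module K (Op I)]
  map : ∀ {I J : Type} [Finite I] [Finite J], (I ≃ J) → (Op I →ₗ[K] Op J)
  one : Op Unit
  comp : ∀ {I J : Type} [Finite I] [Finite J], Op (Option I) →ₗ[K] Op J →ₗ[K] Op (I ⊕ J)
  map_refl : ∀ {I : Type} [Finite I] (p : Op I), map (Equiv.refl I) p = p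
  map_trans : ∀ {I J L : Type} [Finite I] [Finite J] [Finite L] (e : I ≃ J) (f : J ≃ L)
    (p : Op I), map (e.trans f) p = map f (map e p)
  comp_map : ∀ {I I' J J' : Type} [Finite I] [Finite I'] [Finite J] [Finite J'] (e : I ≃ I')
    (f : J ≃ J') (p : Op (Option I)) (q : Op J),
    comp (map e.optionCongr p) (map f q) = map (e.sumCongr f) (comp p q)
  one_comp : ∀ {J : Type} [Finite J] (e : Unit ≃ Option Empty) (q : Op J),
    comp (map e one) q = map (Equiv.emptySum Empty J).symm q
  comp_one : ∀ {I : Type} [Finite I] (p : Op (Option I)),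
    comp p one = map (Equiv.optionEquivSumPUnit I) p
  assoc_seq : ∀ {I J L : Type} [Finite I] [Finite J] [Finite L]
    (p : Op (Option I)) (q : Op (Option J)) (r : Op L),
    comp (map (sumOption I J) (comp p q)) r = map (Equiv.sumAssoc I J L).symm (comp p (comp q r))
  assoc_par : ∀ {I J L : Type} [Finite I] [Finite J] [Finite L]
    (p : Op (Option (Option I))) (q : Op J) (r : Op L),
    comp (map (optionSum I J) (comp p q)) r =
      map (sumRightSwap I J L) (comp (map (optionSum I L) (comp (map (optionSwap I) p) r)) q)

attribute [instance] SymOperad.addCommGroup SymOperad.module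

/-- The operad of a class of algebras: `Op I` is the space of multilinear elements of the free
algebra generated by `I`, and composition is substitution. -/
noncomputable def AlgClass.operad {K : Type u} [Field K] {Ω : Type} (C : AlgClass K Ω) :
    SymOperad K where
  Op I _ := C.multilinearPart I
  addCommGroup I _ := inferInstanceAs (AddCommGroup (C.multilinearPart I))
  module I _ := inferInstanceAs (Module K (C.multilinearPart I))
  map e := (C.rename e).restrict fun _ hf => C.rename_mem e hf
  one := ⟨C.gen (), C.mk_mem (by simp [Mon.IsMultilinear, Mon.letters])⟩
  comp {I J} _ _ := C.insertLinear I J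
  map_refl p := Subtype.ext (C.subst_id p.1)
  map_trans e f p := Subtype.ext (by
    simp [AlgClass.rename, AlgClass.subst_subst])
  comp_map e f p q := Subtype.ext (by
    simp only [AlgClass.insertLinear, LinearMap.mk₂_apply, LinearMap.restrict_apply, AlgClass.insert, AlgClass.rename,
      AlgClass.subst_subst]
    congr 2
    funext o
    cases o <;> simp [AlgClass.subst_subst])
  one_comp e q := Subtype.ext (by
    simp only [AlgClass.insertLinear, LinearMap.mk₂_apply, LinearMap.restrict_apply, AlgClass.insert, AlgClass.rename,
      AlgClass.subst_gen]
    rcases h : e () with _ | x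
    · simp only [Option.elim]
      congr 2
    · exact x.elim)
  comp_one p := Subtype.ext (by
    simp only [AlgClass.insertLinear, LinearMap.mk₂_apply, LinearMap.restrict_apply, AlgClass.insert, AlgClass.rename,
      AlgClass.subst_gen]
    congr 2
    funext o
    cases o <;> simp)
  assoc_seq p q r := Subtype.ext (by
    simp only [AlgClass.insertLinear, LinearMap.mk₂_apply, LinearMap.restrict_apply, AlgClass.insert, AlgClass.rename,
      AlgClass.subst_subst]
    congr 2
    funext o
    cases o with
    | none =>
      simp only [Option.elim, AlgClass.subst_subst, AlgClass.subst_gen]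
      congr 2
      funext o
      cases o <;> simp [sumOption, AlgClass.subst_subst]
    | some x => simp [sumOption])
  assoc_par p q r := Subtype.ext (by
    simp only [AlgClass.insertLinear, LinearMap.mk₂_apply, LinearMap.restrict_apply, AlgClass.insert, AlgClass.rename,
      AlgClass.subst_subst]
    congr 2
    funext o
    rcases o with _ | _ | x <;>
      simp [optionSwap, optionSum, sumRightSwap, AlgClass.subst_subst])

namespace SymOperad

variable {K : Type u} [Field K]

/-- The Hadamard product of operads. -/
noncomputable def hadamard (P Q : SymOperad K) : SymOperad K where
  Op I _ := P.Op I ⊗[K] Q.Op I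
  addCommGroup I _ := inferInstanceAs (AddCommGroup (P.Op I ⊗[K] Q.Op I))
  module I _ := inferInstanceAs (Module K (P.Op I ⊗[K] Q.Op I))
  map e := TensorProduct.map (P.map e) (Q.map e)
  one := P.one ⊗ₜ Q.one
  comp := TensorProduct.map₂ P.comp Q.comp
  map_refl p := by
    induction p with
    | zero => simp
    | tmul x y => simp [P.map_refl, Q.map_refl]
    | add x y hx hy => simp [hx, hy]
  map_trans e f p := by
    induction p with
    | zero => simp
    | tmul x y => simp [P.map_trans, Q.map_trans]
    | add x y hx hy => simp [hx, hy]
  comp_map e f p q := by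
    induction p with
    | zero => simp
    | add x y hx hy => simp only [map_add, LinearMap.add_apply, hx, hy]
    | tmul x y =>
      induction q with
      | zero => simp
      | add x y hx hy => simp only [map_add, hx, hy]
      | tmul x' y' => simp [P.comp_map, Q.comp_map]
  one_comp e q := by
    induction q with
    | zero => simp
    | add x y hx hy => simp only [map_add, hx, hy]
    | tmul x' y' => simp [P.one_comp, Q.one_comp]
  comp_one p := by
    induction p with
    | zero => simp
    | add x y hx hy => simp only [map_add, LinearMap.add_apply, hx, hy]
    | tmul x y => simp [P.comp_one, Q.comp_one]
  assoc_seq p q r := by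
    induction p with
    | zero => simp
    | add x y hx hy => simp only [map_add, LinearMap.add_apply, hx, hy]
    | tmul x y =>
      induction q with
      | zero => simp
      | add x y hx hy => simp only [map_add, LinearMap.add_apply, hx, hy]
      | tmul x' y' =>
        induction r with
        | zero => simp
        | add x y hx hy => simp only [map_add, hx, hy]
        | tmul x'' y'' => simp [P.assoc_seq, Q.assoc_seq]
  assoc_par p q r := by
    induction p with
    | zero => simp
    | add x y hx hy => simp only [map_add, LinearMap.add_apply, hx, hy]
    | tmul x y =>
      induction q with
      | zero => simp
      | add x y hx hy => simp only [map_add, LinearMap.add_apply, hx, hy]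
      | tmul x' y' =>
        induction r with
        | zero => simp
        | add x y hx hy => simp only [map_add, LinearMap.add_apply, hx, hy]
        | tmul x'' y'' =>
          simp only [TensorProduct.map₂_apply_tmul, TensorProduct.map_tmul]
          rw [P.assoc_par, Q.assoc_par]

/-- Sub-operads. -/
structure Sub (P : SymOperad K) where
  carrier : ∀ (I : Type) [Finite I], Submodule K (P.Op I)
  map_mem : ∀ {I J : Type} [Finite I] [Finite J] (e : I ≃ J) {p : P.Op I},
    p ∈ carrier I → P.map e p ∈ carrier J
  one_mem : P.one ∈ carrier Unit
  comp_mem : ∀ {I J : Type} [Finite I] [Finite J] {p : P.Op (Option I)} {q : P.Op J},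
    p ∈ carrier (Option I) → q ∈ carrier J → P.comp p q ∈ carrier (I ⊕ J)

/-- A sub-operad as an operad. -/
noncomputable def Sub.operad {P : SymOperad K} (S : P.Sub) : SymOperad K where
  Op I _ := S.carrier I
  addCommGroup I _ := inferInstanceAs (AddCommGroup (S.carrier I))
  module I _ := inferInstanceAs (Module K (S.carrier I))
  map e := (P.map e).restrict fun _ hp => S.map_mem e hp
  one := ⟨P.one, S.one_mem⟩
  comp := LinearMap.mk₂ K (fun p q => ⟨P.comp p.1 q.1, S.comp_mem p.2 q.2⟩)
    (fun p p' q => Subtype.ext (by simp))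
    (fun c p q => Subtype.ext (by simp))
    (fun p q q' => Subtype.ext (by simp))
    (fun c p q => Subtype.ext (by simp))
  map_refl p := Subtype.ext (P.map_refl p.1)
  map_trans e f p := Subtype.ext (P.map_trans e f p.1)
  comp_map e f p q := Subtype.ext (P.comp_map e f p.1 q.1)
  one_comp e q := Subtype.ext (P.one_comp e q.1)
  comp_one p := Subtype.ext (P.comp_one p.1)
  assoc_seq p q r := Subtype.ext (P.assoc_seq p.1 q.1 r.1)
  assoc_par p q r := Subtype.ext (P.assoc_par p.1 q.1 r.1)

/-- The sub-operad generated by all binary operations. -/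
def binary (P : SymOperad K) : P.Sub where
  carrier I _ := ⨅ (S : P.Sub) (_ : S.carrier (Fin 2) = ⊤), S.carrier I
  map_mem e p hp := by
    simp only [Submodule.mem_iInf] at hp ⊢
    exact fun S hS => S.map_mem e (hp S hS)
  one_mem := by
    simp only [Submodule.mem_iInf]
    exact fun S _ => S.one_mem
  comp_mem hp hq := by
    simp only [Submodule.mem_iInf] at hp hq ⊢
    exact fun S hS => S.comp_mem (hp S hS) (hq S hS)

theorem mem_binary (P : SymOperad K) (p : P.Op (Fin 2)) : p ∈ P.binary.carrier (Fin 2) := by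
  simp only [binary, Submodule.mem_iInf]
  intro S hS
  rw [hS]
  trivial

/-- The Manin white product of (binary) operads: the sub-operad of the Hadamard product
generated by `P(2) ⊗ Q(2)`. -/
noncomputable def white (P Q : SymOperad K) : SymOperad K := (P.hadamard Q).binary.operad

/-- The binary operation `p ⊗ q` of the white product. -/
noncomputable def white.tmul (P Q : SymOperad K) (p : P.Op (Fin 2)) (q : Q.Op (Fin 2)) :
    (P.white Q).Op (Fin 2) :=
  ⟨p ⊗ₜ[K] q, (P.hadamard Q).mem_binary _⟩

/-- The structure of an algebra over an operad on a linear space `B`. -/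
structure Algebra (P : SymOperad K) (B : Type u) [AddCommGroup B] [Module K B] where
  act : ∀ {I : Type} [Finite I], P.Op I →ₗ[K] MultilinearMap K (fun _ : I => B) B
  act_map : ∀ {I J : Type} [Finite I] [Finite J] (e : I ≃ J) (p : P.Op I) (b : J → B),
    act (P.map e p) b = act p (fun i => b (e i))
  act_one : ∀ b : Unit → B, act P.one b = b ()
  act_comp : ∀ {I J : Type} [Finite I] [Finite J] (p : P.Op (Option I)) (q : P.Op J)
    (b : I ⊕ J → B), act (P.comp p q) b =
      act p (fun o => o.elim (act q fun j => b (Sum.inr j)) fun i => b (Sum.inl i))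

theorem update_zero {B : Type u} (a b c : B) : Function.update ![a, b] 0 c = ![c, b] := by
  funext i
  fin_cases i <;> rfl

theorem update_one {B : Type u} (a b c : B) : Function.update ![a, b] 1 c = ![a, c] := by
  funext i
  fin_cases i <;> rfl

/-- The bilinear operation on an algebra given by a binary operation of the operad. -/
def Algebra.bilin {P : SymOperad K} {B : Type u} [AddCommGroup B] [Module K B]
    (α : P.Algebra B) (p : P.Op (Fin 2)) : B →ₗ[K] B →ₗ[K] B :=
  LinearMap.mk₂ K (fun a b => α.act p ![a, b])
    (fun a a' b => by
      have h := (α.act p).map_update_add ![a, b] 0 a a'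
      rwa [update_zero, update_zero, update_zero] at h)
    (fun c a b => by
      have h := (α.act p).map_update_smul ![a, b] 0 c a
      rwa [update_zero, update_zero] at h)
    (fun a b b' => by
      have h := (α.act p).map_update_add ![a, b] 1 b b'
      rwa [update_one, update_one, update_one] at h)
    (fun c a b => by
      have h := (α.act p).map_update_smul ![a, b] 1 c b
      rwa [update_one, update_one] at h)

/-- Isomorphisms of operads. -/
structure Iso (P Q : SymOperad K) where
  equiv : ∀ (I : Type) [Finite I], P.Op I ≃ₗ[K] Q.Op I
  equiv_map : ∀ {I J : Type} [Finite I] [Finite J] (e : I ≃ J) (p : P.Op I),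
    equiv J (P.map e p) = Q.map e (equiv I p)
  equiv_one : equiv Unit P.one = Q.one
  equiv_comp : ∀ {I J : Type} [Finite I] [Finite J] (p : P.Op (Option I)) (q : P.Op J),
    equiv (I ⊕ J) (P.comp p q) = Q.comp (equiv (Option I) p) (equiv J q)

end SymOperad

/-! ### Multilinear varieties, Novikov algebras, derived identities -/

/-- A multilinear variety of algebras with one bilinear multiplication, given by a set of
multilinear defining identities. -/
structure MultilinearVariety (K : Type u) [Field K] where
  ids : Set (Σ n : ℕ, NAPoly K Unit (Fin n))
  multilinear : ∀ f ∈ ids, f.2 ∈ NAPoly.multilinear K Unit (Fin f.1)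

/-- The class of algebras of a multilinear variety. -/
def MultilinearVariety.algebras {K : Type u} [Field K] (V : MultilinearVariety K) :
    AlgClass K Unit :=
  fun A _ _ m => ∀ f ∈ V.ids, ∀ a : Fin f.1 → A, NAPoly.eval m a f.2 = 0

/-- The operad of a multilinear variety. -/
noncomputable abbrev MultilinearVariety.operad {K : Type u} [Field K]
    (V : MultilinearVariety K) : SymOperad K :=
  V.algebras.operad

/-- The variety of Novikov algebras:
`(a ∘ b) ∘ c - a ∘ (b ∘ c) = (b ∘ a) ∘ c - b ∘ (a ∘ c)` and `(a ∘ b) ∘ c = (a ∘ c) ∘ b`. -/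
noncomputable def novikov (K : Type u) [Field K] : MultilinearVariety K :=
  let x (i : Fin 3) : Mon Unit (Fin 3) := Mon.var i
  let m (v w : Mon Unit (Fin 3)) : Mon Unit (Fin 3) := Mon.mul () v w
  { ids := {⟨3, (NAPoly.mon (m (m (x 0) (x 1)) (x 2)) - NAPoly.mon (m (x 0) (m (x 1) (x 2)))) -
        (NAPoly.mon (m (m (x 1) (x 0)) (x 2)) - NAPoly.mon (m (x 1) (m (x 0) (x 2))))⟩,
      ⟨3, NAPoly.mon (m (m (x 0) (x 1)) (x 2)) - NAPoly.mon (m (m (x 0) (x 2)) (x 1))⟩}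
    multilinear := by
      have key : ∀ w : Mon Unit (Fin 3), w.IsMultilinear →
          (NAPoly.mon w : NAPoly K Unit (Fin 3)) ∈ NAPoly.multilinear K Unit (Fin 3) :=
        fun w hw => Submodule.subset_span ⟨w, hw, rfl⟩
      rintro f (rfl | rfl)
      · refine sub_mem (sub_mem (key _ ?_) (key _ ?_)) (sub_mem (key _ ?_) (key _ ?_)) <;>
          exact ⟨by simp [Mon.letters, m, x], by intro i; fin_cases i <;> simp [Mon.letters, m, x]⟩
      · refine sub_mem (key _ ?_) (key _ ?_) <;>
          exact ⟨by simp [Mon.letters, m, x],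
            by intro i; fin_cases i <;> simp [Mon.letters, m, x]⟩ }

/-- The two operations `≺` and `≻`. -/
inductive DOp : Type
  | prec
  | succ

section Derived

variable {K : Type u} [Field K]

/-- `d` is a derivation of the algebra `A` with multiplication `mul`. -/
def IsDer {A : Type u} [AddCommGroup A] [Module K A] (mul : BilinOps K Unit A)
    (d : A →ₗ[K] A) : Prop :=
  ∀ a b, d (mul () a b) = mul () (d a) b + mul () a (d b)

/-- The operations `a ≺ b = a d(b)` and `a ≻ b = d(a) b`. -/
def derivedOps {A : Type u} [AddCommGroup A] [Module K A] (mul : BilinOps K Unit A)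
    (d : A →ₗ[K] A) : BilinOps K DOp A
  | DOp.prec => (mul ()).compl₂ d
  | DOp.succ => (mul ()).comp d

/-- The class of all `A^(d)` for `A` in the variety and `d` a derivation of `A`. -/
def MultilinearVariety.derivedAlgebras (V : MultilinearVariety K) : AlgClass K DOp :=
  fun A _ _ m => ∃ (mul : BilinOps K Unit A) (d : A →ₗ[K] A),
    V.algebras A mul ∧ IsDer mul d ∧ m = derivedOps mul d

/-- Derived identities of a variety: those that hold on all `A^(d)`. -/
def MultilinearVariety.IsDerivedIdentity (V : MultilinearVariety K) {X : Type}
    (f : NAPoly K DOp X) : Prop :=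
  ∀ (A : Type u) [AddCommGroup A] [Module K A] (mul : BilinOps K Unit A) (d : A →ₗ[K] A),
    V.algebras A mul → IsDer mul d → ∀ a : X → A, NAPoly.eval (derivedOps mul d) a f = 0

/-- The operad defined by the derived identities of a variety. -/
noncomputable abbrev MultilinearVariety.derivedOperad (V : MultilinearVariety K) : SymOperad K :=
  V.derivedAlgebras.operad

/-- The multilinear monomial `x_i ω x_j` of degree two as an operation of the operad of a class
of algebras. -/
noncomputable def AlgClass.binaryOp {Ω : Type} (C : AlgClass K Ω) (ω : Ω) (e : Equiv.Perm (Fin 2)) :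
    C.operad.Op (Fin 2) :=
  ⟨C.mk (Mon.mul ω (Mon.var (e 0)) (Mon.var (e 1))), C.mk_mem (by
    refine ⟨?_, fun x => ?_⟩
    · simp [Mon.letters]
    · obtain ⟨i, rfl⟩ := e.surjective x
      fin_cases i <;> simp [Mon.letters])⟩

/-- The operad `Var ∘ Nov`. -/
noncomputable abbrev MultilinearVariety.whiteNov (V : MultilinearVariety K) : SymOperad K :=
  V.operad.white (novikov K).operad

/-- The operations of `Var ∘ Nov`: `x₁ ≺ x₂ = x₁x₂ ⊗ x₁ ∘ x₂` and `x₁ ≻ x₂ = x₁x₂ ⊗ x₂ ∘ x₁`. -/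
noncomputable def MultilinearVariety.whiteOp (V : MultilinearVariety K) :
    DOp → V.whiteNov.Op (Fin 2)
  | DOp.prec => SymOperad.white.tmul _ _ (V.algebras.binaryOp () 1)
      ((novikov K).algebras.binaryOp () 1)
  | DOp.succ => SymOperad.white.tmul _ _ (V.algebras.binaryOp () 1)
      ((novikov K).algebras.binaryOp () (Equiv.swap 0 1))

/-- The identity `f = 0` holds on the variety governed by the operad `Var ∘ Nov`. -/
def MultilinearVariety.HoldsOnWhiteNov (V : MultilinearVariety K) {X : Type}
    (f : NAPoly K DOp X) : Prop :=
  ∀ (B : Type u) [AddCommGroup B] [Module K B] (α : V.whiteNov.Algebra B) (b : X → B),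
    NAPoly.eval (fun ω => α.bilin (V.whiteOp ω)) b f = 0

end Derived

/-! ### Monomials -/

namespace Mon

variable {Ω X Y Z : Type}

/-- Renaming of the variables of a monomial. -/
def map (e : X → Y) (w : Mon Ω X) : Mon Ω Y := w.bind fun x => var (e x)

theorem letters_map (e : X → Y) (w : Mon Ω X) : (w.map e).letters = w.letters.map e := by
  rw [map, letters_bind]
  simp [letters, List.map_eq_flatMap]

theorem map_map (e : X → Y) (f : Y → Z) (w : Mon Ω X) :
    (w.map e).map f = w.map fun x => f (e x) := by
  induction w with
  | var x => rfl
  | mul ω l r hl hr => exact congrArg₂ (mul ω) hl hr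

theorem bind_map (e : X → Y) (φ : Y → Mon Ω Z) (w : Mon Ω X) :
    (w.map e).bind φ = w.bind fun x => φ (e x) := by
  induction w with
  | var x => rfl
  | mul ω l r hl hr => exact congrArg₂ (mul ω) hl hr

theorem map_mul (e : X → Y) (ω : Ω) (l r : Mon Ω X) :
    (mul ω l r).map e = mul ω (l.map e) (r.map e) := rfl

theorem IsMultilinear.map (e : X ≃ Y) {w : Mon Ω X} (hw : w.IsMultilinear) :
    (w.map e).IsMultilinear := by
  refine ⟨?_, fun y => ?_⟩
  · rw [letters_map]
    exact hw.1.map e.injective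
  · rw [letters_map, List.mem_map]
    exact ⟨e.symm y, hw.2 _, by simp⟩

theorem IsMultilinear.mul_sum (ω : Ω) {l : Mon Ω X} {r : Mon Ω Y} (hl : l.IsMultilinear)
    (hr : r.IsMultilinear) : (mul ω (l.map Sum.inl) (r.map Sum.inr)).IsMultilinear := by
  refine ⟨?_, ?_⟩
  · simp only [letters, letters_map, List.nodup_append]
    refine ⟨hl.1.map Sum.inl_injective, hr.1.map Sum.inr_injective, ?_⟩
    simp
  · rintro (x | y)
    · simp [letters, letters_map, hl.2 x]
    · simp [letters, letters_map, hr.2 y]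

/-- Multilinear monomials are built from variables by multiplication of monomials in disjoint sets
of variables and by bijective renaming. -/
theorem multilinear_induction {p : ∀ (I : Type) [Finite I], Mon Ω I → Prop}
    (var : p Unit (var ()))
    (map : ∀ {I J : Type} [Finite I] [Finite J] (e : I ≃ J) (w : Mon Ω I), w.IsMultilinear →
      p I w → p J (w.map e))
    (mul : ∀ {I J : Type} [Finite I] [Finite J] (ω : Ω) (l : Mon Ω I) (r : Mon Ω J),
      l.IsMultilinear → r.IsMultilinear → p I l → p J r →
      p (I ⊕ J) (mul ω (l.map Sum.inl) (r.map Sum.inr)))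
    {I : Type} [Finite I] (w : Mon Ω I) (hw : w.IsMultilinear) : p I w := by
  have key : ∀ w : Mon Ω I, ∃ (P : Type) (_ : Finite P) (s : Mon Ω P) (e : P → I),
      s.IsMultilinear ∧ p P s ∧ w = s.map e := by
    intro w
    induction w with
    | var x =>
      exact ⟨Unit, inferInstance, Mon.var (), fun _ => x, by simp [IsMultilinear, letters], var, rfl⟩
    | mul ω l r hl hr =>
      obtain ⟨P, _, s, e, h1, h2, rfl⟩ := hl
      obtain ⟨Q, _, t, f, h3, h4, rfl⟩ := hr
      refine ⟨P ⊕ Q, inferInstance, Mon.mul ω (s.map Sum.inl) (t.map Sum.inr), Sum.elim e f,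
        h1.mul_sum ω h3, mul ω s t h1 h3 h2 h4, ?_⟩
      rw [map_mul, map_map, map_map]
      rfl
  obtain ⟨P, _, s, e, h1, h2, rfl⟩ := key w
  have he : Function.Bijective e := by
    constructor
    · have := hw.1
      rw [letters_map] at this
      intro a b hab
      exact List.inj_on_of_nodup_map this (h1.2 a) (h1.2 b) hab
    · intro i
      have := hw.2 i
      rw [letters_map, List.mem_map] at this
      obtain ⟨a, _, ha⟩ := this
      exact ⟨a, ha⟩
  exact map (Equiv.ofBijective e he) s h1 h2

section eval

variable {K : Type u} [Field K] {A : Type u} [AddCommGroup A] [Module K A]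

theorem eval_map (m : BilinOps K Ω A) (a : Y → A) (e : X → Y) (w : Mon Ω X) :
    (w.map e).eval m a = w.eval m fun x => a (e x) := eval_bind m a _ w

theorem eval_update_of_notMem [DecidableEq X] (m : BilinOps K Ω A) (a : X → A) (w : Mon Ω X)
    {i : X} (hi : i ∉ w.letters) (b : A) :
    w.eval m (Function.update a i b) = w.eval m a := by
  refine eval_congr m w fun x hx => ?_
  rw [Function.update_of_ne]
  rintro rfl
  exact hi hx

theorem eval_update [DecidableEq X] (m : BilinOps K Ω A) (a : X → A) (w : Mon Ω X)
    (hn : w.letters.Nodup) {i : X} (hi : i ∈ w.letters) (s : K) (b c : A) :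
    w.eval m (Function.update a i (s • b + c)) =
      s • w.eval m (Function.update a i b) + w.eval m (Function.update a i c) := by
  induction w with
  | var x =>
    simp only [letters, List.mem_singleton] at hi
    subst hi
    simp [eval]
  | mul ω l r hl hr =>
    simp only [letters, List.nodup_append] at hn
    obtain ⟨hnl, hnr, hd⟩ := hn
    simp only [letters, List.mem_append] at hi
    simp only [eval]
    by_cases h : i ∈ l.letters
    · have h' : i ∉ r.letters := fun h2 => hd _ h _ h2 rfl
      simp only [hl hnl h, eval_update_of_notMem m a r h', map_add, map_smul, LinearMap.add_apply,
        LinearMap.smul_apply]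
    · simp only [hr hnr (hi.resolve_left h), eval_update_of_notMem m a l h, map_add, map_smul]

end eval

end Mon

namespace NAPoly

variable {K : Type u} [Field K] {Ω X : Type} {A : Type u} [AddCommGroup A] [Module K A]

theorem multilinear_induction {p : NAPoly K Ω X → Prop}
    (hm : ∀ w : Mon Ω X, w.IsMultilinear → p (mon w)) (h0 : p 0)
    (ha : ∀ f g, p f → p g → p (f + g)) (hs : ∀ (c : K) f, p f → p (c • f))
    {f : NAPoly K Ω X} (hf : f ∈ multilinear K Ω X) : p f := by
  induction hf using Submodule.span_induction with
  | mem x hx => obtain ⟨w, hw, rfl⟩ := hx; exact hm w hw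
  | zero => exact h0
  | add x y _ _ hx hy => exact ha x y hx hy
  | smul c x _ hx => exact hs c x hx

theorem eval_update [DecidableEq X] (m : BilinOps K Ω A) {f : NAPoly K Ω X}
    (hf : f ∈ multilinear K Ω X) (a : X → A) (i : X) (s : K) (b c : A) :
    eval m (Function.update a i (s • b + c)) f =
      s • eval m (Function.update a i b) f + eval m (Function.update a i c) f := by
  refine multilinear_induction (p := fun f => eval m (Function.update a i (s • b + c)) f =
      s • eval m (Function.update a i b) f + eval m (Function.update a i c) f) ?_ ?_ ?_ ?_ hf
  · intro w hw
    simpa only [eval_mon] using w.eval_update m a hw.1 (hw.2 i) s b c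
  · simp
  · intro f g hf hg
    simp only [map_add, hf, hg, smul_add]
    abel
  · intro t f hf
    simp only [map_smul, hf, smul_add, smul_comm t s]

/-- A multilinear polynomial defines a multilinear map on every algebra. -/
noncomputable def multilinearEval (m : BilinOps K Ω A) (f : NAPoly K Ω X)
    (hf : f ∈ multilinear K Ω X) : MultilinearMap K (fun _ : X => A) A where
  toFun a := eval m a f
  map_update_add' a i b c := by
    simpa using eval_update m hf a i 1 b c
  map_update_smul' a i s b := by
    have h0 := eval_update m hf a i 1 0 0
    simp only [one_smul, add_zero, left_eq_add] at h0
    simpa [h0] using eval_update m hf a i s b 0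

end NAPoly

/-! ### Algebras of a class as algebras over its operad -/

namespace AlgClass

variable {K : Type u} [Field K] {Ω : Type} (C : AlgClass K Ω) {X Y : Type}
variable {A : Type u} [AddCommGroup A] [Module K A]

/-- The homomorphism from the free algebra to an algebra of the class which extends a map of
the generators. -/
noncomputable def evalFree {m : BilinOps K Ω A} (hm : C A m) (a : X → A) : C.Free X →ₗ[K] A :=
  (C.identities X).liftQ (NAPoly.eval m a) fun _ hf => LinearMap.mem_ker.2 (hf A m hm a)

variable {m : BilinOps K Ω A} (hm : C A m)

@[simp] theorem evalFree_mk (a : X → A) (w : Mon Ω X) :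
    C.evalFree hm a (C.mk w) = w.eval m a := NAPoly.eval_mon m a w

theorem evalFree_freeOps (a : X → A) (ω : Ω) (f g : C.Free X) :
    C.evalFree hm a (C.freeOps ω f g) = m ω (C.evalFree hm a f) (C.evalFree hm a g) := by
  obtain ⟨f, rfl⟩ := (C.identities X).mkQ_surjective f
  obtain ⟨g, rfl⟩ := (C.identities X).mkQ_surjective g
  rw [freeOps_mk]
  exact NAPoly.eval_ops m a ω f g

theorem evalFree_subst (a : Y → A) (φ : X → C.Free Y) (f : C.Free X) :
    C.evalFree hm a (C.subst φ f) = C.evalFree hm (fun x => C.evalFree hm a (φ x)) f := by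
  have h : C.evalFree hm a ∘ₗ C.subst φ = C.evalFree hm (fun x => C.evalFree hm a (φ x)) := by
    refine C.free_ext fun w => ?_
    simp only [LinearMap.comp_apply, subst_mk, evalFree_mk]
    induction w with
    | var x => rfl
    | mul ω l r hl hr => simp only [Mon.eval, evalFree_freeOps, hl, hr]
  exact LinearMap.congr_fun h f

/-- The multilinear map on an algebra of the class given by an operation of the operad. -/
noncomputable def actOfMem (p : C.multilinearPart X) : MultilinearMap K (fun _ : X => A) A where
  toFun a := C.evalFree hm a p
  map_update_add' a i b c := by
    obtain ⟨_, f, hf, rfl⟩ := p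
    exact (NAPoly.multilinearEval m f hf).map_update_add a i b c
  map_update_smul' a i s b := by
    obtain ⟨_, f, hf, rfl⟩ := p
    exact (NAPoly.multilinearEval m f hf).map_update_smul a i s b

/-- Every algebra of the class is an algebra over the operad of the class. -/
noncomputable def operadAlgebra : C.operad.Algebra A where
  act {I} _ :=
    { toFun := fun p => C.actOfMem hm (X := I) p
      map_add' := fun p q => MultilinearMap.ext fun a => map_add (C.evalFree hm a) p.1 q.1
      map_smul' := fun c p => MultilinearMap.ext fun a => map_smul (C.evalFree hm a) c p.1 }
  act_map e p b := by
    refine (C.evalFree_subst hm b _ p.1).trans ?_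
    exact congrArg (fun a => C.evalFree hm a p.1) (funext fun x => C.evalFree_mk hm b _)
  act_one b := C.evalFree_mk hm b _
  act_comp p q b := by
    refine (C.evalFree_subst hm b _ p.1).trans ?_
    refine congrArg (fun a => C.evalFree hm a p.1) (funext fun o => ?_)
    cases o with
    | none =>
      refine (C.evalFree_subst hm b _ q.1).trans ?_
      exact congrArg (fun a => C.evalFree hm a q.1) (funext fun x => C.evalFree_mk hm b _)
    | some x => exact C.evalFree_mk hm b _

theorem operadAlgebra_bilin (ω : Ω) : (C.operadAlgebra hm).bilin (C.binaryOp ω 1) = m ω := by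
  ext a b
  exact C.evalFree_mk hm ![a, b] _

/-! ### Compositions of monomials -/

/-- A multilinear monomial as an operation of the operad. -/
noncomputable def opMon {I : Type} [Finite I] (w : Mon Ω I) (hw : w.IsMultilinear) :
    C.operad.Op I := ⟨C.mk w, C.mk_mem hw⟩

theorem rename_mk (e : X → Y) (w : Mon Ω X) : C.rename e (C.mk w) = C.mk (w.map e) := by
  rw [rename, subst_mk]
  exact C.eval_mk _ w

theorem insert_mk (w : Mon Ω (Option X)) (v : Mon Ω Y) : C.insert (C.mk w) (C.mk v) =
    C.mk (w.bind fun o => o.elim (v.map Sum.inr) fun x => Mon.var (Sum.inl x)) := by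
  rw [insert, subst_mk, ← eval_mk]
  congr 1
  funext o
  cases o with
  | none => exact C.rename_mk _ v
  | some x => rfl

theorem map_opMon {I J : Type} [Finite I] [Finite J] (e : I ≃ J) (w : Mon Ω I)
    (hw : w.IsMultilinear) : C.operad.map e (C.opMon w hw) = C.opMon (w.map e) (hw.map e) :=
  Subtype.ext (C.rename_mk e w)

/-- `Fin 2 ≃ {∗, x}`. -/
def finTwoEquivOption : Fin 2 ≃ Option Unit where
  toFun := ![none, some ()]
  invFun o := o.elim 0 fun _ => 1
  left_inv i := by fin_cases i <;> rfl
  right_inv o := by rcases o with _ | _ <;> rfl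

/-- `{x} ⊔ I ≃ I ⊔ {∗}`. -/
def unitSumEquivOption (I : Type) : Unit ⊕ I ≃ Option I where
  toFun := Sum.elim (fun _ => none) some
  invFun o := o.elim (Sum.inl ()) Sum.inr
  left_inv := by rintro (_ | _) <;> rfl
  right_inv := by rintro (_ | _) <;> rfl

/-- The composition of a binary operation with two operations. -/
noncomputable def _root_.SymOperad.comp₂ (P : SymOperad K) {I J : Type} [Finite I] [Finite J]
    (p : P.Op (Fin 2)) (q : P.Op I) (r : P.Op J) : P.Op (I ⊕ J) :=
  P.comp (P.map (unitSumEquivOption I) (P.comp (P.map finTwoEquivOption p) q)) r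

theorem opMon_mul {I J : Type} [Finite I] [Finite J] (ω : Ω) (l : Mon Ω I) (r : Mon Ω J)
    (hl : l.IsMultilinear) (hr : r.IsMultilinear) :
    C.opMon (Mon.mul ω (l.map Sum.inl) (r.map Sum.inr)) (hl.mul_sum ω hr) =
      C.operad.comp₂ (C.binaryOp ω 1) (C.opMon l hl) (C.opMon r hr) := by
  refine Subtype.ext ?_
  change _ = C.insert (C.rename (unitSumEquivOption I) (C.insert (C.rename finTwoEquivOption
    (C.mk _)) (C.mk l))) (C.mk r)
  rw [rename_mk, insert_mk, rename_mk, insert_mk]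
  change C.mk _ = C.mk (Mon.mul ω (((l.map Sum.inr).map _).bind _) (r.map Sum.inr))
  rw [Mon.map_map, Mon.bind_map]
  rfl

end AlgClass

theorem SymOperad.Sub.comp₂_mem {K : Type u} [Field K] {P : SymOperad K} (S : P.Sub) {I J : Type}
    [Finite I] [Finite J] {p : P.Op (Fin 2)} {q : P.Op I} {r : P.Op J}
    (hp : p ∈ S.carrier (Fin 2)) (hq : q ∈ S.carrier I) (hr : r ∈ S.carrier J) :
    P.comp₂ p q r ∈ S.carrier (I ⊕ J) :=
  S.comp_mem (S.map_mem _ (S.comp_mem (S.map_mem _ hp) hq)) hr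

theorem SymOperad.Algebra.act_comp₂ {K : Type u} [Field K] {P : SymOperad K} {B : Type u}
    [AddCommGroup B] [Module K B] (α : P.Algebra B) {I J : Type}
    [Finite I] [Finite J] (p : P.Op (Fin 2)) (q : P.Op I) (r : P.Op J) (b : I ⊕ J → B) :
    α.act (P.comp₂ p q r) b =
      α.bilin p (α.act q fun i => b (Sum.inl i)) (α.act r fun j => b (Sum.inr j)) := by
  rw [SymOperad.comp₂, α.act_comp, α.act_map, α.act_comp, α.act_map]
  change α.act p _ = α.act p _
  congr 1
  funext i
  fin_cases i <;> rfl

namespace AlgClass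

variable {K : Type u} [Field K] {Ω : Type} (C : AlgClass K Ω)

/-- The operad of a class of algebras is generated by the operations. -/
theorem sub_eq_top (S : C.operad.Sub) (h : ∀ ω, C.binaryOp ω 1 ∈ S.carrier (Fin 2))
    {I : Type} [Finite I] (p : C.operad.Op I) : p ∈ S.carrier I := by
  have key : ∀ (w : Mon Ω I) (hw : w.IsMultilinear), C.opMon w hw ∈ S.carrier I := by
    intro w hw
    refine Mon.multilinear_induction
      (p := fun I _ w => ∀ hw : w.IsMultilinear, C.opMon w hw ∈ S.carrier I) ?_ ?_ ?_ w hw hw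
    · exact fun _ => S.one_mem
    · intro I J _ _ e w hw hp _
      rw [← C.map_opMon e w hw]
      exact S.map_mem e (hp hw)
    · intro I J _ _ ω l r hl hr hpl hpr _
      rw [C.opMon_mul ω l r hl hr]
      exact S.comp₂_mem (h ω) (hpl hl) (hpr hr)
  obtain ⟨p, hp⟩ := p
  suffices h : ∃ hp, (⟨p, hp⟩ : C.operad.Op I) ∈ S.carrier I from h.2
  refine C.multilinear_induction
    (p := fun p => ∃ hp, (⟨p, hp⟩ : C.operad.Op I) ∈ S.carrier I) ?_ ?_ ?_ ?_ hp
  · exact fun w hw => ⟨_, key w hw⟩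
  · exact ⟨_, zero_mem (S.carrier I)⟩
  · rintro f g ⟨_, hf⟩ ⟨_, hg⟩
    exact ⟨_, add_mem hf hg⟩
  · rintro c f ⟨_, hf⟩
    exact ⟨_, Submodule.smul_mem _ c hf⟩

/-- The action of a multilinear polynomial on an algebra over the operad. -/
theorem act_mkQ {B : Type u} [AddCommGroup B] [Module K B] (α : C.operad.Algebra B)
    {I : Type} [Finite I] {f : NAPoly K Ω I} (hf : f ∈ NAPoly.multilinear K Ω I) (b : I → B) :
    α.act (⟨(C.identities I).mkQ f, ⟨f, hf, rfl⟩⟩ : C.operad.Op I) b =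
      NAPoly.eval (fun ω => α.bilin (C.binaryOp ω 1)) b f := by
  have key : ∀ (w : Mon Ω I) (hw : w.IsMultilinear),
      α.act (C.opMon w hw) b = w.eval (fun ω => α.bilin (C.binaryOp ω 1)) b := by
    intro w hw
    refine Mon.multilinear_induction
      (p := fun I _ w => ∀ (hw : w.IsMultilinear) (b : I → B),
        α.act (C.opMon w hw) b = w.eval (fun ω => α.bilin (C.binaryOp ω 1)) b) ?_ ?_ ?_ w hw hw b
    · exact fun _ b => α.act_one b
    · intro I J _ _ e w hw hp _ b
      rw [← C.map_opMon e w hw, α.act_map, hp, Mon.eval_map]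
    · intro I J _ _ ω l r hl hr hpl hpr _ b
      rw [C.opMon_mul ω l r hl hr, α.act_comp₂, hpl, hpr, Mon.eval, Mon.eval_map, Mon.eval_map]
  let L : C.operad.Op I →ₗ[K] B :=
    { toFun := fun p => α.act p b
      map_add' := fun p q => by rw [map_add]; rfl
      map_smul' := fun c p => by rw [map_smul]; rfl }
  suffices h : ∃ hf : (C.identities I).mkQ f ∈ C.multilinearPart I,
      L ⟨_, hf⟩ = NAPoly.eval (fun ω => α.bilin (C.binaryOp ω 1)) b f from h.2
  refine NAPoly.multilinear_induction (p := fun f =>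
    ∃ hf : (C.identities I).mkQ f ∈ C.multilinearPart I,
      L ⟨_, hf⟩ = NAPoly.eval (fun ω => α.bilin (C.binaryOp ω 1)) b f)
    ?_ ?_ ?_ ?_ hf
  · intro w hw
    exact ⟨C.mk_mem hw, (key w hw).trans (NAPoly.eval_mon _ _ _).symm⟩
  · exact ⟨zero_mem _, L.map_zero.trans (map_zero _).symm⟩
  · rintro f g ⟨hf, hf'⟩ ⟨hg, hg'⟩
    exact ⟨add_mem hf hg, (L.map_add ⟨_, hf⟩ ⟨_, hg⟩).trans (by rw [hf', hg', map_add])⟩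
  · rintro c f ⟨hf, hf'⟩
    exact ⟨Submodule.smul_mem _ c hf, (L.map_smul c ⟨_, hf⟩).trans (by rw [hf', map_smul])⟩

end AlgClass

/-! ### Commutative rings acting on Novikov algebras -/

theorem Multiset.map_erase_cons {X S : Type*} [DecidableEq X] (W : Multiset X) (b : X)
    (f : X → Multiset X → S) :
    (W.map fun c => f c ((b ::ₘ W).erase c)) = W.map fun c => f c (b ::ₘ W.erase c) := by
  refine Multiset.map_congr rfl fun c hc => ?_
  by_cases h : c = b
  · subst h
    rw [Multiset.erase_cons_head, Multiset.cons_erase hc]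
  · rw [Multiset.erase_cons_tail _ (Ne.symm h)]

section NovikovAction

variable {S A X : Type*} [CommRing S] [AddCommGroup A] [Module S A]

/-- An additive map `R : A → S` such that `a ∘ b = R b • a` is a Novikov product on `A`, and such that
`s ↦ R (s • a) - s * R a` is a derivation of `S` for every `a`. -/
structure IsNovikovAction (R : A →+ S) : Prop where
  symm : ∀ (s : S) (a b : A), (R (s • a) - s * R a) • b = (R (s • b) - s * R b) • a
  leibniz : ∀ (s t : S) (a : A), R ((s * t) • a) + s * t * R a = s * R (t • a) + t * R (s • a)

variable [DecidableEq X] (R : A →+ S) (x : X → A)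

/-- The element of `S` which stands for the product of the elements `x z`, `z ∈ Z`, with
the derivative of `x y` of order `card Z + 1`. -/
noncomputable def novSlot (y : X) (Z : Multiset X) : S :=
  open Classical in
  if h : ∃ a, a ∈ Z then
    R (novSlot y (Z.erase h.choose) • x h.choose) -
      (Z.attach.map fun c : {c // c ∈ Z} => R (x c) * novSlot y (Z.erase c)).sum
  else R (x y)
termination_by Z.card
decreasing_by
  · exact Multiset.card_erase_lt_of_mem h.choose_spec
  · exact Multiset.card_erase_lt_of_mem c.2

theorem novSlot_zero (y : X) : novSlot R x y 0 = R (x y) := by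
  rw [novSlot, dif_neg (by simp)]

variable {R}

theorem novSlot_cons_of_symm (y : X) (b : X) (W : Multiset X)
    (h : ∀ a ∈ b ::ₘ W, ∀ c ∈ b ::ₘ W,
      novSlot R x y ((b ::ₘ W).erase a) • x a = novSlot R x y ((b ::ₘ W).erase c) • x c) :
    novSlot R x y (b ::ₘ W) = (R (novSlot R x y W • x b) - novSlot R x y W * R (x b))
        - (W.map fun c => R (x c) * novSlot R x y (b ::ₘ W.erase c)).sum := by
  have hZ : ∃ a, a ∈ b ::ₘ W := ⟨b, Multiset.mem_cons_self b W⟩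
  rw [novSlot, dif_pos hZ, h _ hZ.choose_spec b (Multiset.mem_cons_self b W)]
  have := congrArg Multiset.sum (Multiset.attach_map_val' (b ::ₘ W)
    fun c => R (x c) * novSlot R x y ((b ::ₘ W).erase c))
  rw [this, Multiset.map_cons, Multiset.sum_cons, Multiset.erase_cons_head,
    Multiset.map_erase_cons W b fun c Z => R (x c) * novSlot R x y Z]
  ring

theorem novSlot_symm_aux (hR : IsNovikovAction R) (y : X) (n : ℕ) : ∀ (W : Multiset X),
    W.card = n → ∀ a b : X,
    novSlot R x y (b ::ₘ W) • x a = novSlot R x y (a ::ₘ W) • x b := by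
  induction n using Nat.strong_induction_on with
  | _ n ih =>
    intro W hW
    have key : ∀ b, novSlot R x y (b ::ₘ W) = (R (novSlot R x y W • x b) - novSlot R x y W * R (x b))
        - (W.map fun c => R (x c) * novSlot R x y (b ::ₘ W.erase c)).sum := by
      intro b
      refine novSlot_cons_of_symm x y b W fun c hc d hd => ?_
      by_cases hcd : c = d
      · rw [hcd]
      · obtain ⟨V, hV⟩ := Multiset.exists_cons_of_mem hc
        have hd' : d ∈ V := by
          rw [hV] at hd
          exact (Multiset.mem_cons.1 hd).resolve_left (Ne.symm hcd)
        obtain ⟨V, rfl⟩ := Multiset.exists_cons_of_mem hd'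
        have hcard := congrArg Multiset.card hV
        simp only [Multiset.card_cons, hW] at hcard
        rw [hV, Multiset.erase_cons_head, Multiset.erase_cons_tail _ hcd,
          Multiset.erase_cons_head]
        exact ih V.card (by omega) V rfl c d
    intro a b
    rw [key a, key b, sub_smul, sub_smul _ _ (x b), hR.symm]
    congr 1
    rw [Multiset.sum_smul, Multiset.sum_smul, Multiset.map_map, Multiset.map_map]
    refine congrArg Multiset.sum (Multiset.map_congr rfl fun c hc => ?_)
    simp only [Function.comp_apply, mul_smul]
    rw [ih (W.erase c).card (hW ▸ Multiset.card_erase_lt_of_mem hc) (W.erase c) rfl a b]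

/-- The value of `novSlot y (b ::ₘ W) • x a` is symmetric in `a` and `b`. -/
theorem novSlot_smul_symm (hR : IsNovikovAction R) (y : X) (W : Multiset X) (a b : X) :
    novSlot R x y (b ::ₘ W) • x a = novSlot R x y (a ::ₘ W) • x b :=
  novSlot_symm_aux x hR y _ W rfl a b

theorem novSlot_cons (hR : IsNovikovAction R) (y b : X) (W : Multiset X) :
    novSlot R x y (b ::ₘ W) = (R (novSlot R x y W • x b) - novSlot R x y W * R (x b))
        - (W.map fun c => R (x c) * novSlot R x y (b ::ₘ W.erase c)).sum := by
  refine novSlot_cons_of_symm x y b W fun c hc d hd => ?_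
  by_cases hcd : c = d
  · rw [hcd]
  · obtain ⟨V, hV⟩ := Multiset.exists_cons_of_mem hc
    have hd' : d ∈ V := by
      rw [hV] at hd
      exact (Multiset.mem_cons.1 hd).resolve_left (Ne.symm hcd)
    obtain ⟨V, rfl⟩ := Multiset.exists_cons_of_mem hd'
    rw [hV, Multiset.erase_cons_head, Multiset.erase_cons_tail _ hcd, Multiset.erase_cons_head]
    exact novSlot_smul_symm x hR y V c d

theorem novSlot_mul_exchange (hR : IsNovikovAction R) (y w : X) (W : Multiset X) (a b : X)
    (n : ℕ) : ∀ V : Multiset X, V.card = n →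
    novSlot R x y (a ::ₘ W) * novSlot R x w (b ::ₘ V) =
      novSlot R x y (b ::ₘ W) * novSlot R x w (a ::ₘ V) := by
  induction n using Nat.strong_induction_on with
  | _ n ih =>
    intro V hV
    have hlin : ∀ (u s : S) (e : A), u * (R (s • e) - s * R e) = R (s • u • e) - s * R (u • e) := by
      intro u s e
      have := hR.leibniz s u e
      rw [mul_smul] at this
      linear_combination -this
    rw [novSlot_cons x hR w b V, novSlot_cons x hR w a V,
      mul_sub (novSlot R x y (a ::ₘ W)), mul_sub (novSlot R x y (b ::ₘ W)), hlin, hlin,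
      novSlot_smul_symm x hR y W b a]
    congr 1
    rw [← Multiset.sum_map_mul_left, ← Multiset.sum_map_mul_left]
    refine congrArg Multiset.sum (Multiset.map_congr rfl fun c hc => ?_)
    have := ih (V.erase c).card (hV ▸ Multiset.card_erase_lt_of_mem hc) (V.erase c) rfl
    linear_combination R (x c) * this

/-- The product of the elements `novSlot y Z` for the pairs `(y, Z)` in `B`. -/
noncomputable def novProd (R : A →+ S) (x : X → A) (B : Multiset (X × Multiset X)) : S :=
  (B.map fun p => novSlot R x p.1 p.2).prod

theorem novProd_cons (p : X × Multiset X) (B : Multiset (X × Multiset X)) :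
    novProd R x (p ::ₘ B) = novSlot R x p.1 p.2 * novProd R x B := by
  simp [novProd]

theorem novProd_add (B B' : Multiset (X × Multiset X)) :
    novProd R x (B + B') = novProd R x B * novProd R x B' := by
  simp [novProd]

/-- The first entries of the pairs in `B` with the sizes of the second ones. -/
def slotShape (B : Multiset (X × Multiset X)) : Multiset (X × ℕ) :=
  B.map fun p => (p.1, p.2.card)

/-- All elements of the second entries of the pairs in `B`. -/
def slotSum (B : Multiset (X × Multiset X)) : Multiset X :=
  (B.map Prod.snd).sum

omit [DecidableEq X] in
theorem slotSum_cons (p : X × Multiset X) (B : Multiset (X × Multiset X)) :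
    slotSum (p ::ₘ B) = p.2 + slotSum B := by
  simp [slotSum]

omit [DecidableEq X] in
theorem exists_cons_of_mem_slotSum {B : Multiset (X × Multiset X)} {b : X} (hb : b ∈ slotSum B) :
    ∃ w V B', B = (w, b ::ₘ V) ::ₘ B' := by
  rw [slotSum, ← Multiset.join, Multiset.mem_join] at hb
  obtain ⟨Z, hZ, hb⟩ := hb
  obtain ⟨⟨w, Z⟩, hp, rfl⟩ := Multiset.mem_map.1 hZ
  obtain ⟨V, hV⟩ := Multiset.exists_cons_of_mem hb
  obtain ⟨B', rfl⟩ := Multiset.exists_cons_of_mem hp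
  simp only at hV
  exact ⟨w, V, B', by rw [hV]⟩

theorem exists_novSlot_mul_novProd (hR : IsNovikovAction R) (y : X) (Z : Multiset X) (n : ℕ) :
    ∀ (Z' : Multiset X) (B : Multiset (X × Multiset X)), (Z - Z').card = n → Z'.card = Z.card →
      Z ≤ Z' + slotSum B → ∃ B', slotShape B' = slotShape B ∧
        Z + slotSum B' = Z' + slotSum B ∧
        novSlot R x y Z' * novProd R x B = novSlot R x y Z * novProd R x B' := by
  induction n with
  | zero =>
    intro Z' B hn hc hle
    have h : Z = Z' := Multiset.eq_of_le_of_card_le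
      (tsub_eq_zero_iff_le.1 (Multiset.card_eq_zero.1 hn)) hc.le
    subst h
    exact ⟨B, rfl, rfl, rfl⟩
  | succ n ih =>
    intro Z' B hn hc hle
    obtain ⟨b, hb⟩ := Multiset.card_pos_iff_exists_mem.1 (by omega : 0 < (Z - Z').card)
    have hlt : Z'.count b < Z.count b := by
      have := Multiset.count_pos.2 hb
      rw [Multiset.count_sub] at this
      omega
    have hbB : b ∈ slotSum B := by
      have h1 := Multiset.count_le_of_le b hle
      rw [Multiset.count_add] at h1
      exact Multiset.count_pos.1 (by omega)
    obtain ⟨a, ha⟩ : ∃ a, a ∈ Z' - Z := by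
      by_contra! h
      have h0 : Z' ≤ Z := tsub_eq_zero_iff_le.1 (Multiset.eq_zero_of_forall_notMem h)
      rw [Multiset.eq_of_le_of_card_le h0 hc.ge] at hlt
      exact lt_irrefl _ hlt
    have hlt' : Z.count a < Z'.count a := by
      have := Multiset.count_pos.2 ha
      rw [Multiset.count_sub] at this
      omega
    obtain ⟨W, rfl⟩ := Multiset.exists_cons_of_mem (Multiset.count_pos.1 (by omega : 0 < Z'.count a))
    obtain ⟨w, V, B, rfl⟩ := exists_cons_of_mem_slotSum hbB
    have hab : a ≠ b := by
      rintro rfl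
      omega
    have hsum : (b ::ₘ W) + slotSum ((w, a ::ₘ V) ::ₘ B) =
        (a ::ₘ W) + slotSum ((w, b ::ₘ V) ::ₘ B) := by
      simp only [slotSum_cons]
      simp only [← Multiset.singleton_add]
      abel
    obtain ⟨B', h1, h2, h3⟩ := ih (b ::ₘ W) ((w, a ::ₘ V) ::ₘ B) (by
        have h : Z - (a ::ₘ W) = b ::ₘ (Z - (b ::ₘ W)) := by
          ext c
          simp only [Multiset.count_sub, Multiset.count_cons] at hlt hlt' ⊢
          split_ifs at * <;> subst_vars <;> simp_all <;> omega
        rw [h, Multiset.card_cons] at hn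
        omega) (by simpa using hc) (by rw [hsum]; exact hle)
    refine ⟨B', ?_, by rw [h2, hsum], ?_⟩
    · rw [h1]
      simp [slotShape]
    · rw [← h3, novProd_cons, novProd_cons]
      have := novSlot_mul_exchange x hR y w W a b _ V rfl
      linear_combination novProd R x B * this

theorem novProd_eq (hR : IsNovikovAction R) (B : Multiset (X × Multiset X)) :
    ∀ B', slotShape B = slotShape B' → slotSum B = slotSum B' →
      novProd R x B = novProd R x B' := by
  induction B using Multiset.induction_on with
  | empty =>
    intro B' h _
    have : B' = 0 := by
      simpa [slotShape, eq_comm] using h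
    rw [this]
  | cons p B ih =>
    intro B' h1 h2
    obtain ⟨y, Z⟩ := p
    obtain ⟨⟨y', Z'⟩, hp, he⟩ := Multiset.mem_map.1
      (h1 ▸ (by simp [slotShape] : (y, Z.card) ∈ slotShape ((y, Z) ::ₘ B)))
    obtain ⟨B', rfl⟩ := Multiset.exists_cons_of_mem hp
    simp only [Prod.mk.injEq] at he
    obtain ⟨rfl, hc⟩ := he
    simp only [slotShape, Multiset.map_cons, hc, Multiset.cons_inj_right] at h1
    simp only [slotSum, Multiset.map_cons, Multiset.sum_cons] at h2
    obtain ⟨B'', h3, h4, h5⟩ := exists_novSlot_mul_novProd x hR y' Z _ Z' B' rfl hc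
      (h2 ▸ Multiset.le_add_right _ _)
    rw [novProd_cons, novProd_cons]
    simp only
    rw [h5, ih B'' (h1.trans h3.symm) (add_left_cancel (h2.trans h4.symm))]

theorem novProd_smul_eq (hR : IsNovikovAction R) (B B' : Multiset (X × Multiset X)) (z z' : X)
    (h1 : slotShape B = slotShape B') (h2 : z ::ₘ slotSum B = z' ::ₘ slotSum B') :
    novProd R x B • x z = novProd R x B' • x z' := by
  by_cases hz : z = z'
  · subst hz
    rw [novProd_eq x hR B B' h1 (Multiset.cons_inj_right _ |>.1 h2)]
  · have : z' ∈ slotSum B :=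
      (Multiset.mem_cons.1 (h2 ▸ Multiset.mem_cons_self z' _)).resolve_left (Ne.symm hz)
    obtain ⟨w, V, B, rfl⟩ := exists_cons_of_mem_slotSum this
    have h : novProd R x ((w, z' ::ₘ V) ::ₘ B) • x z =
        novProd R x ((w, z ::ₘ V) ::ₘ B) • x z' := by
      rw [novProd_cons, novProd_cons, mul_comm, mul_comm _ (novProd R x B), mul_smul, mul_smul]
      simp only
      rw [novSlot_smul_symm x hR w V z z']
    rw [h, novProd_eq x hR _ B']
    · rw [← h1]
      simp [slotShape]
    · refine (Multiset.cons_inj_right z').1 (Eq.trans ?_ h2)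
      simp only [slotSum_cons]
      simp only [← Multiset.singleton_add]
      abel

end NovikovAction

/-! ### Differential polynomials -/

section DiffPoly

open MvPolynomial

variable (K : Type u) [Field K] (X : Type)

/-- Differential polynomials in the variables `X`: the pair `(i, k)` is the `k`-th derivative
of the variable `i`. -/
abbrev DiffPoly : Type u := MvPolynomial (X × ℕ) K

/-- The derivation of the algebra of differential polynomials. -/
noncomputable def diffDer : Derivation K (DiffPoly K X) (DiffPoly K X) :=
  mkDerivation K fun p => MvPolynomial.X (p.1, p.2 + 1)

/-- The Novikov product `p ∘ q = p d(q)` of differential polynomials. -/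
noncomputable def diffOps : BilinOps K Unit (DiffPoly K X) := fun _ =>
  (LinearMap.mul K (DiffPoly K X)).compl₂ (diffDer K X).toLinearMap

variable {K X}

theorem diffOps_apply (p q : DiffPoly K X) : diffOps K X () p q = p * diffDer K X q := rfl

theorem diffDer_X (i : X) (k : ℕ) :
    diffDer K X (MvPolynomial.X (i, k)) = MvPolynomial.X (i, k + 1) := by
  simp [diffDer]

/-- The differential monomial with a given multiset of factors. -/
noncomputable def diffMon (M : Multiset (X × ℕ)) : DiffPoly K X := (M.map MvPolynomial.X).prod

theorem diffMon_cons (p : X × ℕ) (M : Multiset (X × ℕ)) :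
    (diffMon (p ::ₘ M) : DiffPoly K X) = MvPolynomial.X p * diffMon M := by
  simp [diffMon]

theorem diffMon_add (M N : Multiset (X × ℕ)) :
    (diffMon (M + N) : DiffPoly K X) = diffMon M * diffMon N := by
  simp [diffMon]

theorem diffMon_eq_monomial [DecidableEq X] (M : Multiset (X × ℕ)) :
    (diffMon M : DiffPoly K X) = monomial (Multiset.toFinsupp M) 1 := by
  induction M using Multiset.induction_on with
  | empty => simp [diffMon]
  | cons p M ih =>
    rw [diffMon_cons, ih, ← Multiset.singleton_add, map_add, Multiset.toFinsupp_singleton,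
      monomial_single_add, pow_one]

theorem diffDer_multiset_prod [DecidableEq X] (f : X → DiffPoly K X) (Z : Multiset X) :
    diffDer K X (Z.map f).prod =
      (Z.map fun c => diffDer K X (f c) * ((Z.erase c).map f).prod).sum := by
  induction Z using Multiset.induction_on with
  | empty => simp
  | cons b Z ih =>
    rw [Multiset.map_cons, Multiset.prod_cons, Derivation.leibniz, ih, Multiset.map_cons,
      Multiset.sum_cons, Multiset.erase_cons_head,
      Multiset.map_erase_cons Z b fun c W => diffDer K X (f c) * (W.map f).prod]
    simp only [smul_eq_mul, Multiset.map_cons, Multiset.prod_cons, mul_left_comm _ (f b),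
      Multiset.sum_map_mul_left]
    ring

/-- The factors of the differential monomial given by the pairs `(y, Z)` in `B`: the derivative
of `y` of order `card Z + 1` and all elements of `Z`. -/
def slotExp (B : Multiset (X × Multiset X)) : Multiset (X × ℕ) :=
  (slotShape B).map (fun p => (p.1, p.2 + 1)) + (slotSum B).map fun c => (c, 0)

theorem slotExp_cons (y : X) (Z : Multiset X) (B : Multiset (X × Multiset X)) :
    slotExp ((y, Z) ::ₘ B) = (y, Z.card + 1) ::ₘ (Z.map (fun c => (c, 0)) + slotExp B) := by
  simp only [slotExp, slotShape, slotSum_cons, Multiset.map_cons, Multiset.map_add,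
    Multiset.cons_add]
  congr 1
  abel

theorem slotExp_add (B B' : Multiset (X × Multiset X)) :
    slotExp (B + B') = slotExp B + slotExp B' := by
  simp only [slotExp, slotShape, slotSum, Multiset.map_add, Multiset.sum_add]
  abel

theorem eq_of_slotExp_eq {B B' : Multiset (X × Multiset X)} {z z' : X}
    (h : (z, 0) ::ₘ slotExp B = (z', 0) ::ₘ slotExp B') :
    slotShape B = slotShape B' ∧ z ::ₘ slotSum B = z' ::ₘ slotSum B' := by
  classical
  have key : ∀ (z : X) (B : Multiset (X × Multiset X)),
      (((z, 0) ::ₘ slotExp B).filter fun p => p.2 ≠ 0).map (fun p => (p.1, p.2 - 1)) =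
        slotShape B ∧
      (((z, 0) ::ₘ slotExp B).filter fun p => p.2 = 0).map Prod.fst = z ::ₘ slotSum B := by
    intro z B
    constructor <;>
      simp [slotExp, Multiset.filter_map]
  exact ⟨by rw [← (key z B).1, h, (key z' B').1], by rw [← (key z B).2, h, (key z' B').2]⟩

theorem exists_diffDer_slotExp {S A : Type*} [CommRing S] [AddCommGroup A] [Module S A]
    [DecidableEq X] {R : A →+ S} (hR : IsNovikovAction R) (x : X → A) (z : X)
    (B : Multiset (X × Multiset X)) :
    ∃ T : Multiset (Multiset (X × Multiset X)),
      diffDer K X (diffMon ((z, 0) ::ₘ slotExp B)) = (T.map fun B' => diffMon (slotExp B')).sum ∧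
      R (novProd R x B • x z) = (T.map fun B' => novProd R x B').sum := by
  induction B using Multiset.induction_on with
  | empty =>
    refine ⟨{{(z, 0)}}, ?_, ?_⟩
    · have h : slotExp ({(z, 0)} : Multiset (X × Multiset X)) = {(z, 1)} := by
        simp [slotExp, slotShape, slotSum]
      simp only [Multiset.map_singleton, Multiset.sum_singleton, h]
      simp [diffMon, slotExp, slotShape, slotSum, diffDer_X]
    · simp [novProd, novSlot_zero]
  | cons p B ih =>
    obtain ⟨y, Z⟩ := p
    obtain ⟨T, h1, h2⟩ := ih
    refine ⟨T.map ((y, Z) ::ₘ ·) + ({(y, z ::ₘ Z) ::ₘ B} +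
      Z.map fun c => (c, 0) ::ₘ (y, z ::ₘ Z.erase c) ::ₘ B), ?_, ?_⟩
    · have e : ∀ (y : X) (Z : Multiset X) (B : Multiset (X × Multiset X)),
          (diffMon (slotExp ((y, Z) ::ₘ B)) : DiffPoly K X) = MvPolynomial.X (y, Z.card + 1) *
            (Z.map fun c => MvPolynomial.X (c, 0)).prod * diffMon (slotExp B) := by
        intro y Z B
        rw [slotExp_cons, diffMon_cons, diffMon_add, mul_assoc]
        congr 2
        simp [diffMon, Multiset.map_map]
      have e3 : ∀ c ∈ Z, (diffMon (slotExp ((c, 0) ::ₘ (y, z ::ₘ Z.erase c) ::ₘ B)) : DiffPoly K X) =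
          (MvPolynomial.X (y, Z.card + 1) * MvPolynomial.X (z, 0) * diffMon (slotExp B)) *
          (MvPolynomial.X (c, 1) * ((Z.erase c).map fun c => MvPolynomial.X (c, 0)).prod) := by
        intro c hc
        rw [e, e, Multiset.card_cons, Multiset.card_erase_add_one hc]
        simp only [Multiset.map_zero, Multiset.prod_zero, Multiset.card_zero, zero_add,
          Multiset.map_cons, Multiset.prod_cons]
        ring
      simp only [Multiset.map_add, Multiset.sum_add, Multiset.map_map, Function.comp_def,
        Multiset.map_singleton, Multiset.sum_singleton]
      rw [Multiset.map_congr rfl e3, Multiset.sum_map_mul_left]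
      simp only [e, Multiset.sum_map_mul_left]
      rw [← h1, diffMon_cons, diffMon_cons, e]
      simp only [Derivation.leibniz, diffDer_multiset_prod, smul_eq_mul, diffDer_X, Multiset.map_cons,
        Multiset.prod_cons, Multiset.card_cons]
      ring
    · have e3 : ∀ c ∈ Z, novProd R x ((c, 0) ::ₘ (y, z ::ₘ Z.erase c) ::ₘ B) =
          novProd R x B * (R (x c) * novSlot R x y (z ::ₘ Z.erase c)) := by
        intro c _
        rw [novProd_cons, novProd_cons, novSlot_zero]
        ring
      simp only [Multiset.map_add, Multiset.sum_add, Multiset.map_map, Function.comp_def,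
        Multiset.map_singleton, Multiset.sum_singleton]
      rw [Multiset.map_congr rfl e3, Multiset.sum_map_mul_left]
      simp only [novProd_cons, Multiset.sum_map_mul_left]
      rw [← h2, novSlot_cons x hR]
      have := hR.leibniz (novSlot R x y Z) (novProd R x B) (x z)
      linear_combination this

variable {S A : Type u} [CommRing S] [AddCommGroup A] [Module S A] [Module K A] [DecidableEq X]
  {R : A →+ S}

variable (K) in
theorem exists_linearMap_diffMon (hR : IsNovikovAction R) (x : X → A) :
    ∃ Ψ : DiffPoly K X →ₗ[K] A, ∀ z B,
      Ψ (diffMon ((z, 0) ::ₘ slotExp B)) = novProd R x B • x z := by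
  classical
  let P : (X × ℕ →₀ ℕ) → X × Multiset (X × Multiset X) → Prop := fun M q =>
    (q.1, 0) ::ₘ slotExp q.2 = Finsupp.toMultiset M
  refine ⟨(basisMonomials (X × ℕ) K).constr K fun M =>
    if h : ∃ q, P M q then novProd R x h.choose.2 • x h.choose.1 else 0, fun z B => ?_⟩
  rw [diffMon_eq_monomial, ← congrFun (coe_basisMonomials (X × ℕ) K), Module.Basis.constr_basis]
  have h : ∃ q, P (Multiset.toFinsupp ((z, 0) ::ₘ slotExp B)) q :=
    ⟨(z, B), (Multiset.toFinsupp_toMultiset _).symm⟩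
  rw [dif_pos h]
  have h' : P _ h.choose := h.choose_spec
  obtain ⟨h1, h2⟩ := eq_of_slotExp_eq (h'.trans (Multiset.toFinsupp_toMultiset _))
  exact novProd_smul_eq x hR _ _ _ _ h1 h2

variable (K X) in
/-- The linear span of the differential monomials `z Q`, where `z` is a variable and `Q`
is a product of factors of the form `z₁ ⋯ zₖ d^(k+1)(y)`. -/
noncomputable def novSpan : Submodule K (DiffPoly K X) :=
  Submodule.span K (Set.range fun q : X × Multiset (X × Multiset X) =>
    diffMon ((q.1, 0) ::ₘ slotExp q.2))

theorem diffOps_mem_novSpan (hR : IsNovikovAction R) (x : X → A) (m : BilinOps K Unit A)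
    (hm : ∀ a b, m () a b = R b • a) (Ψ : DiffPoly K X →ₗ[K] A)
    (hΨ : ∀ z B, Ψ (diffMon ((z, 0) ::ₘ slotExp B)) = novProd R x B • x z)
    {p q : DiffPoly K X} (hp : p ∈ novSpan K X) (hq : q ∈ novSpan K X) :
    diffOps K X () p q ∈ novSpan K X ∧ Ψ (diffOps K X () p q) = m () (Ψ p) (Ψ q) := by
  induction hp using Submodule.span_induction with
  | zero => simp
  | add p p' _ _ h h' =>
    simp only [map_add, LinearMap.add_apply]
    exact ⟨add_mem h.1 h'.1, by rw [h.2, h'.2]⟩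
  | smul c p _ h =>
    simp only [map_smul, LinearMap.smul_apply]
    exact ⟨Submodule.smul_mem _ _ h.1, by rw [h.2]⟩
  | mem p hp =>
    obtain ⟨⟨z, B⟩, rfl⟩ := hp
    induction hq using Submodule.span_induction with
    | zero => simp
    | add p p' _ _ h h' =>
      simp only [map_add]
      exact ⟨add_mem h.1 h'.1, by rw [h.2, h'.2]⟩
    | smul c p _ h =>
      simp only [map_smul]
      exact ⟨Submodule.smul_mem _ _ h.1, by rw [h.2]⟩
    | mem q hq =>
      obtain ⟨⟨z', B'⟩, rfl⟩ := hq
      obtain ⟨T, h1, h2⟩ := exists_diffDer_slotExp (K := K) hR x z' B'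
      simp only [diffOps_apply, h1, ← Multiset.sum_map_mul_left, ← diffMon_add,
        Multiset.cons_add, ← slotExp_add]
      refine ⟨multiset_sum_mem _ fun a ha => ?_, ?_⟩
      · obtain ⟨B'', _, rfl⟩ := Multiset.mem_map.1 ha
        exact Submodule.subset_span ⟨(z, B + B''), rfl⟩
      · rw [map_multiset_sum, Multiset.map_map, hm, hΨ, hΨ, h2, Multiset.sum_smul,
          Multiset.map_map]
        refine congrArg Multiset.sum (Multiset.map_congr rfl fun B'' _ => ?_)
        simp only [Function.comp_apply, hΨ, novProd_add, mul_smul]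
        rw [smul_comm]

theorem eval_eq_zero_of_diffOps (hR : IsNovikovAction R) (x : X → A) (m : BilinOps K Unit A)
    (hm : ∀ a b, m () a b = R b • a) {f : NAPoly K Unit X}
    (hf : NAPoly.eval (diffOps K X) (fun i => MvPolynomial.X (i, 0)) f = 0) :
    NAPoly.eval m x f = 0 := by
  obtain ⟨Ψ, hΨ⟩ := exists_linearMap_diffMon K hR x
  have h : Ψ ∘ₗ NAPoly.eval (diffOps K X) (fun i => MvPolynomial.X (i, 0)) = NAPoly.eval m x := by
    refine NAPoly.hom_ext fun v => ?_
    simp only [LinearMap.comp_apply, NAPoly.eval_mon]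
    suffices h : v.eval (diffOps K X) (fun i => MvPolynomial.X (i, 0)) ∈ novSpan K X ∧
      Ψ (v.eval (diffOps K X) (fun i => MvPolynomial.X (i, 0))) = v.eval m x from h.2
    induction v with
    | var i =>
      have hi : (MvPolynomial.X (i, 0) : DiffPoly K X) = diffMon ((i, 0) ::ₘ slotExp 0) := by
        simp [diffMon, slotExp, slotShape, slotSum]
      simp only [Mon.eval]
      rw [hi, hΨ]
      exact ⟨Submodule.subset_span ⟨(i, 0), rfl⟩, by simp [novProd]⟩
    | mul ω l r hl hr =>
      have := diffOps_mem_novSpan hR x m hm Ψ hΨ hl.1 hr.1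
      rw [hl.2, hr.2] at this
      exact this
  rw [← h, LinearMap.comp_apply, hf, map_zero]

end DiffPoly

/-! ### Novikov algebras -/

section Novikov

variable {K : Type u} [Field K] {A : Type u} [AddCommGroup A] [Module K A]

theorem novikov_algebras_iff (m : BilinOps K Unit A) : (novikov K).algebras A m ↔
    (∀ a b c, m () (m () a b) c - m () a (m () b c) = m () (m () b a) c - m () b (m () a c)) ∧
      ∀ a b c, m () (m () a b) c = m () (m () a c) b := by
  constructor
  · intro h
    constructor
    · intro a b c
      have := h _ (Or.inl rfl) ![a, b, c]
      simpa [Mon.eval, sub_eq_zero] using this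
    · intro a b c
      have := h _ (Or.inr rfl) ![a, b, c]
      simpa [Mon.eval, sub_eq_zero] using this
  · rintro ⟨h1, h2⟩ f (rfl | rfl) a
    · simpa [Mon.eval, sub_eq_zero] using h1 (a 0) (a 1) (a 2)
    · simpa [Mon.eval, sub_eq_zero] using h2 (a 0) (a 1) (a 2)

/-- Differential polynomials form a Novikov algebra. -/
theorem novikov_diffOps (X : Type) : (novikov K).algebras (DiffPoly K X) (diffOps K X) := by
  rw [novikov_algebras_iff]
  simp only [diffOps_apply, Derivation.leibniz, smul_eq_mul]
  exact ⟨fun a b c => by ring, fun a b c => by ring⟩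

/-- The operators of right multiplication generate a commutative algebra which acts on
the Novikov algebra. -/
theorem exists_isNovikovAction (m : BilinOps K Unit A) (h : (novikov K).algebras A m) :
    ∃ (S : Type u) (_ : CommRing S) (_ : Module S A) (R : A →+ S), IsNovikovAction R ∧
      ∀ a b, m () a b = R b • a := by
  obtain ⟨h1, h2⟩ := (novikov_algebras_iff m).1 h
  let s : Set (Module.End K A) := Set.range (m ()).flip
  have hs : ∀ a ∈ s, ∀ b ∈ s, a * b = b * a := by
    rintro _ ⟨a, rfl⟩ _ ⟨b, rfl⟩
    ext c
    exact h2 c b a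
  have hcomm := Algebra.isMulCommutative_adjoin K hs
  have hc : ∀ t ∈ Algebra.adjoin K s, ∀ t' ∈ Algebra.adjoin K s, ∀ a, t (t' a) = t' (t a) := by
    intro t ht t' ht' a
    have := hcomm.is_comm.comm ⟨t, ht⟩ ⟨t', ht'⟩
    exact LinearMap.congr_fun (congrArg Subtype.val this) a
  have hL : ∀ t ∈ Algebra.adjoin K s, ∀ a c, m () (t a) c = t (m () a c) := by
    intro t ht
    induction ht using Algebra.adjoin_induction with
    | mem t ht =>
      obtain ⟨b, rfl⟩ := ht
      exact fun a c => h2 a b c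
    | algebraMap k => intro a c; simp [Module.algebraMap_end_apply]
    | add t t' _ _ ht ht' => intro a c; simp [ht, ht']
    | mul t t' _ _ ht ht' => intro a c; simp [ht, ht']
  have hD : ∀ t ∈ Algebra.adjoin K s, ∀ a c,
      m () c (t a) = m () a (t c) - t (m () a c) + t (m () c a) := by
    intro t ht
    induction ht using Algebra.adjoin_induction with
    | mem t ht =>
      obtain ⟨b, rfl⟩ := ht
      intro a c
      have := h1 c a b
      simp only [LinearMap.flip_apply]
      rw [sub_eq_iff_eq_add] at this
      rw [this]
      abel
    | algebraMap k => intro a c; simp [Module.algebraMap_end_apply]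
    | add t t' _ _ ht ht' =>
      intro a c
      simp only [LinearMap.add_apply, map_add, ht a c, ht' a c]
      abel
    | mul t t' h h' ht ht' =>
      intro a c
      simp only [Module.End.mul_apply]
      have e1 := ht (t' a) c
      have e2 := ht a (t' c)
      have e3 := congrArg t' (ht a c)
      have e4 := congrArg t (ht' a c)
      simp only [map_add, map_sub, hL t' h', hc t' h' t h] at e1 e2 e3 e4
      rw [e1, e4]
      rw [e3] at e2
      rw [sub_eq_iff_eq_add.1 (add_right_cancel e2)]
      abel
  let S := Algebra.adjoin K s
  let _ : CommRing S := { (inferInstance : Ring S) with mul_comm := hcomm.is_comm.comm }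
  let R : A →+ S :=
    { toFun := fun b => ⟨(m ()).flip b, Algebra.subset_adjoin ⟨b, rfl⟩⟩
      map_zero' := Subtype.ext (map_zero _)
      map_add' := fun b c => Subtype.ext (map_add _ b c) }
  refine ⟨S, inferInstance, inferInstance, R,
    ⟨fun t a b => ?_, fun t t' a => ?_⟩, fun _ _ => rfl⟩
  · change m () b (t.1 a) - t.1 (m () b a) = m () a (t.1 b) - t.1 (m () a b)
    rw [hD t.1 t.2 a b]
    abel
  · refine Subtype.ext (LinearMap.ext fun c => ?_)
    change m () c (t.1 (t'.1 a)) + t.1 (t'.1 (m () c a)) =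
      t.1 (m () c (t'.1 a)) + t'.1 (m () c (t.1 a))
    have e1 := hD t.1 t.2 (t'.1 a) c
    have e2 := congrArg t'.1 (hD t.1 t.2 a c)
    simp only [map_add, map_sub, hL t'.1 t'.2, hc t'.1 t'.2 t.1 t.2] at e1 e2
    rw [e1, e2]
    abel

/-- The free Novikov algebra embeds into the algebra of differential polynomials. -/
theorem mem_identities_novikov_of_diffOps {X : Type} {f : NAPoly K Unit X}
    (hf : NAPoly.eval (diffOps K X) (fun i => MvPolynomial.X (i, 0)) f = 0) :
    f ∈ (novikov K).algebras.identities X := by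
  classical
  intro A _ _ m hm a
  obtain ⟨S, _, _, R, hR, h⟩ := exists_isNovikovAction m hm
  exact eval_eq_zero_of_diffOps hR a m h hf

end Novikov

/-! ### Monomials in the operations `≺`, `≻` -/

namespace Mon

variable {X Y : Type}

/-- The product of the variables of a monomial in the operations `≺`, `≻` in the same order. -/
def forget : Mon DOp X → Mon Unit X
  | var x => var x
  | mul _ l r => mul () l.forget r.forget

/-- The Novikov monomial that corresponds to a monomial in the operations `≺`, `≻`:
`a ≺ b = a ∘ b` and `a ≻ b = b ∘ a`. -/
def toNov : Mon DOp X → Mon Unit X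
  | var x => var x
  | mul DOp.prec l r => mul () l.toNov r.toNov
  | mul DOp.succ l r => mul () r.toNov l.toNov

theorem letters_forget (w : Mon DOp X) : w.forget.letters = w.letters := by
  induction w with
  | var x => rfl
  | mul ω l r hl hr => simp [forget, letters, hl, hr]

theorem letters_toNov (w : Mon DOp X) : w.toNov.letters.Perm w.letters := by
  induction w with
  | var x => rfl
  | mul ω l r hl hr =>
    cases ω
    · exact hl.append hr
    · exact (hr.append hl).trans List.perm_append_comm

theorem IsMultilinear.forget {w : Mon DOp X} (hw : w.IsMultilinear) : w.forget.IsMultilinear := by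
  rwa [IsMultilinear, letters_forget]

theorem IsMultilinear.toNov {w : Mon DOp X} (hw : w.IsMultilinear) : w.toNov.IsMultilinear :=
  ⟨(letters_toNov w).nodup_iff.2 hw.1, fun x => (letters_toNov w).mem_iff.2 (hw.2 x)⟩

theorem forget_bind (φ : X → Mon DOp Y) (w : Mon DOp X) :
    (w.bind φ).forget = w.forget.bind fun x => (φ x).forget := by
  induction w with
  | var x => rfl
  | mul ω l r hl hr => exact congrArg₂ (mul ()) hl hr

theorem toNov_bind (φ : X → Mon DOp Y) (w : Mon DOp X) :
    (w.bind φ).toNov = w.toNov.bind fun x => (φ x).toNov := by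
  induction w with
  | var x => rfl
  | mul ω l r hl hr =>
    cases ω
    · exact congrArg₂ (mul ()) hl hr
    · exact congrArg₂ (mul ()) hr hl

end Mon

/-! ### Extension of scalars -/

section TensorOps

variable {K : Type u} [Field K] {B C : Type u} [AddCommGroup B] [Module K B] [CommRing C]
  [Algebra K C]

/-- The tensor product of an algebra with a commutative associative algebra. -/
noncomputable def tensorOps (C : Type u) [CommRing C] [Algebra K C] (m : BilinOps K Unit B) :
    BilinOps K Unit (B ⊗[K] C) :=
  fun _ => TensorProduct.map₂ (m ()) (LinearMap.mul K C)

theorem tensorOps_tmul (m : BilinOps K Unit B) (a b : B) (c d : C) :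
    tensorOps C m () (a ⊗ₜ c) (b ⊗ₜ d) = m () a b ⊗ₜ (c * d) := rfl

theorem Mon.eval_tensorOps {X : Type} (m : BilinOps K Unit B) (b : X → B) (c : X → C)
    (w : Mon Unit X) : w.eval (tensorOps C m) (fun x => b x ⊗ₜ[K] c x) =
      w.eval m b ⊗ₜ[K] (w.letters.map c).prod := by
  induction w with
  | var x => simp [eval, letters]
  | mul ω l r hl hr =>
    rw [eval, hl, hr, tensorOps_tmul]
    simp [eval, letters]

theorem NAPoly.eval_tensorOps {X : Type} [Fintype X] (m : BilinOps K Unit B) (b : X → B)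
    (c : X → C) {f : NAPoly K Unit X} (hf : f ∈ NAPoly.multilinear K Unit X) :
    NAPoly.eval (tensorOps C m) (fun x => b x ⊗ₜ[K] c x) f =
      NAPoly.eval m b f ⊗ₜ[K] ∏ x, c x := by
  classical
  refine NAPoly.multilinear_induction (p := fun f =>
    NAPoly.eval (tensorOps C m) (fun x => b x ⊗ₜ[K] c x) f =
      NAPoly.eval m b f ⊗ₜ[K] ∏ x, c x) ?_ ?_ ?_ ?_ hf
  · intro w hw
    have h : w.letters.toFinset = Finset.univ := by
      ext x
      simp [hw.2 x]
    rw [eval_mon, eval_mon, Mon.eval_tensorOps, ← List.prod_toFinset c hw.1, h]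
  · simp
  · intro f g hf hg
    rw [map_add, map_add, hf, hg, TensorProduct.add_tmul]
  · intro s f hf
    rw [map_smul, map_smul, hf, TensorProduct.smul_tmul']

theorem MultilinearVariety.tensorOps_mem (V : MultilinearVariety K) (m : BilinOps K Unit B)
    (hm : V.algebras B m) : V.algebras (B ⊗[K] C) (tensorOps C m) := by
  intro f hf a
  let e := (Module.Basis.ofVectorSpace K B).tensorProduct (Module.Basis.ofVectorSpace K C)
  have h : NAPoly.multilinearEval (tensorOps C m) f.2 (V.multilinear f hf) = 0 := by
    refine Module.Basis.ext_multilinear (fun _ => e) fun v => ?_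
    have hv : (fun i => e (v i)) = fun i => Module.Basis.ofVectorSpace K B (v i).1 ⊗ₜ[K]
        Module.Basis.ofVectorSpace K C (v i).2 :=
      funext fun i => Module.Basis.tensorProduct_apply _ _ _ _
    change NAPoly.eval (tensorOps C m) (fun i => e (v i)) f.2 = 0
    rw [hv]
    rw [NAPoly.eval_tensorOps m _ _ (V.multilinear f hf), hm f hf, TensorProduct.zero_tmul]
  exact congrFun (congrArg DFunLike.coe h) a

theorem isDer_tensorOps (m : BilinOps K Unit B) (D : Derivation K C C) :
    IsDer (tensorOps C m) (D.toLinearMap.lTensor B) := by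
  intro a b
  induction a with
  | zero => simp
  | add a a' h h' =>
    simp only [map_add, LinearMap.add_apply, h, h']
    abel
  | tmul a c =>
    induction b with
    | zero => simp
    | add b b' h h' =>
      simp only [map_add, h, h']
      abel
    | tmul b d =>
      simp only [LinearMap.lTensor_tmul, tensorOps_tmul, Derivation.coeFn_coe,
        Derivation.leibniz, smul_eq_mul, TensorProduct.tmul_add]
      rw [mul_comm d, add_comm]

end TensorOps

/-! ### Derived identities and differential polynomials -/

namespace MultilinearVariety

variable {K : Type u} [Field K] (V : MultilinearVariety K) {X : Type}

theorem freeOps_mem (X : Type) : V.algebras (V.algebras.Free X) V.algebras.freeOps := by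
  intro f hf a
  have h : f.2 ∈ V.algebras.identities (Fin f.1) := fun A _ _ m hm a => hm f hf a
  have h' : V.algebras.subst a ((V.algebras.identities (Fin f.1)).mkQ f.2) = 0 := by
    rw [Submodule.mkQ_apply, (Submodule.Quotient.mk_eq_zero _).2 h, map_zero]
  exact h'

theorem mem_derivedIdentities_iff {f : NAPoly K DOp X} :
    f ∈ V.derivedAlgebras.identities X ↔ V.IsDerivedIdentity f := by
  constructor
  · intro h A _ _ mul d hmul hd a
    exact h A _ ⟨mul, d, hmul, hd, rfl⟩ a
  · rintro h A _ _ _ ⟨mul, d, hmul, hd, rfl⟩ a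
    exact h A mul d hmul hd a

/-- The operations `≺`, `≻` on the tensor product of the free algebra of the variety with the algebra
of differential polynomials. -/
noncomputable def tensorDiffOps (X : Type) :
    BilinOps K DOp (V.algebras.Free X ⊗[K] DiffPoly K X) :=
  derivedOps (tensorOps (DiffPoly K X) V.algebras.freeOps)
    ((diffDer K X).toLinearMap.lTensor (V.algebras.Free X))

theorem tensorDiffOps_mem (X : Type) : V.derivedAlgebras _ (V.tensorDiffOps X) :=
  ⟨_, _, V.tensorOps_mem _ (V.freeOps_mem X), isDer_tensorOps _ _, rfl⟩

/-- The homomorphism from the free algebra of the variety defined by the derived identities to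
the tensor product of the free algebra of the variety with the algebra of differential polynomials. -/
noncomputable def toTensorDiff (X : Type) :
    V.derivedAlgebras.Free X →ₗ[K] V.algebras.Free X ⊗[K] DiffPoly K X :=
  V.derivedAlgebras.evalFree (V.tensorDiffOps_mem X) fun i =>
    V.algebras.gen i ⊗ₜ MvPolynomial.X (i, 0)

theorem toTensorDiff_mk (w : Mon DOp X) : V.toTensorDiff X (V.derivedAlgebras.mk w) =
    V.algebras.mk w.forget ⊗ₜ
      w.toNov.eval (diffOps K X) fun i => MvPolynomial.X (i, 0) := by
  rw [toTensorDiff, AlgClass.evalFree_mk]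
  induction w with
  | var x => rfl
  | mul ω l r hl hr =>
    have h : V.algebras.mk (Mon.mul () l.forget r.forget) =
        V.algebras.freeOps () (V.algebras.mk l.forget) (V.algebras.mk r.forget) := by
      simp only [AlgClass.mk, AlgClass.freeOps_mk, NAPoly.ops_mon]
    cases ω
    · rw [Mon.eval, hl, hr, Mon.forget, Mon.toNov, h]
      rfl
    · rw [Mon.eval, hl, hr, Mon.forget, Mon.toNov, h, Mon.eval, diffOps_apply, mul_comm]
      rfl

variable (K) in
/-- The embedding of the free Novikov algebra into the algebra of differential polynomials. -/
noncomputable def novToDiff (X : Type) : (novikov K).algebras.Free X →ₗ[K] DiffPoly K X :=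
  (novikov K).algebras.evalFree (novikov_diffOps X) fun i => MvPolynomial.X (i, 0)

theorem novToDiff_injective (X : Type) : Function.Injective (novToDiff K X) := by
  rw [← LinearMap.ker_eq_bot, LinearMap.ker_eq_bot']
  intro p hp
  obtain ⟨f, rfl⟩ := ((novikov K).algebras.identities X).mkQ_surjective p
  exact (Submodule.Quotient.mk_eq_zero _).2 (mem_identities_novikov_of_diffOps hp)

theorem toTensorDiff_mk' (w : Mon DOp X) : V.toTensorDiff X (V.derivedAlgebras.mk w) =
    V.algebras.mk w.forget ⊗ₜ novToDiff K X ((novikov K).algebras.mk w.toNov) := by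
  rw [toTensorDiff_mk, novToDiff, AlgClass.evalFree_mk]

end MultilinearVariety

/-! ### Evaluation of tensors in algebras with a derivation -/

section DerivationEval

variable {K : Type u} [Field K] {X : Type}

/-- The product of the derivatives of the variables in `s` of orders given by `k`. -/
noncomputable def listMon (K : Type u) [Field K] (s : List X) (k : X → ℕ) : DiffPoly K X :=
  (s.map fun i => MvPolynomial.X (i, k i)).prod

theorem listMon_congr {s : List X} {k k' : X → ℕ} (h : ∀ i ∈ s, k i = k' i) :
    listMon K s k = listMon K s k' := by
  rw [listMon, List.map_congr_left fun i hi => by rw [h i hi]]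
  rfl

theorem diffDer_listMon [DecidableEq X] (s : List X) (hs : s.Nodup) (k : X → ℕ) :
    diffDer K X (listMon K s k) = (s.map fun j => listMon K s (k + Pi.single j 1)).sum := by
  induction s with
  | nil => simp [listMon]
  | cons i s ih =>
    obtain ⟨hi, hs⟩ := List.nodup_cons.1 hs
    have h1 : listMon K s (k + Pi.single i 1) = listMon K s k := by
      refine listMon_congr fun j hj => ?_
      have : j ≠ i := by rintro rfl; exact hi hj
      simp [this]
    have h2 : ∀ j ∈ s, listMon K (i :: s) (k + Pi.single j 1) =
        MvPolynomial.X (i, k i) * listMon K s (k + Pi.single j 1) := by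
      intro j hj
      have : i ≠ j := by rintro rfl; exact hi hj
      simp [listMon, this]
    have h3 : ∀ k : X → ℕ, listMon K (i :: s) k = MvPolynomial.X (i, k i) * listMon K s k := by
      intro k
      simp [listMon]
    rw [List.map_cons, List.sum_cons, List.map_congr_left h2, List.sum_map_mul_left, ← ih hs,
      h3, h3, h1, Derivation.leibniz, diffDer_X]
    simp only [smul_eq_mul, Pi.add_apply, Pi.single_eq_same]
    ring

variable {A : Type u} [AddCommGroup A] [Module K A]

theorem IsDer.map_eval [DecidableEq X] {m : BilinOps K Unit A} {d : A →ₗ[K] A} (hd : IsDer m d)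
    (a : X → A) (v : Mon Unit X) (hv : v.letters.Nodup) (k : X → ℕ) :
    d (v.eval m fun i => (d ^ k i) (a i)) =
      (v.letters.map fun j => v.eval m fun i => (d ^ (k + Pi.single j 1 : X → ℕ) i) (a i)).sum := by
  induction v with
  | var x =>
    simp [Mon.eval, Mon.letters, pow_succ']
  | mul ω l r hl hr =>
    simp only [Mon.letters, List.nodup_append] at hv
    obtain ⟨hnl, hnr, hdis⟩ := hv
    have h1 : ∀ j ∈ l.letters, (r.eval m fun i => (d ^ (k + Pi.single j 1 : X → ℕ) i) (a i)) =
        r.eval m fun i => (d ^ k i) (a i) := by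
      intro j hj
      refine Mon.eval_congr m r fun i hi => ?_
      simp [(hdis j hj i hi).symm]
    have h2 : ∀ j ∈ r.letters, (l.eval m fun i => (d ^ (k + Pi.single j 1 : X → ℕ) i) (a i)) =
        l.eval m fun i => (d ^ k i) (a i) := by
      intro j hj
      refine Mon.eval_congr m l fun i hi => ?_
      simp [hdis i hi j hj]
    simp only [Mon.eval, Mon.letters, List.map_append, List.sum_append]
    rw [hd, hl hnl, hr hnr]
    congr 1
    · rw [← LinearMap.flip_apply, map_list_sum, List.map_map]
      refine congrArg List.sum (List.map_congr_left fun j hj => ?_)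
      rw [h1 j hj]
      rfl
    · rw [map_list_sum, List.map_map]
      refine congrArg List.sum (List.map_congr_left fun j hj => ?_)
      rw [h2 j hj]
      rfl

variable (K) in
/-- The span of the differential monomials in which exactly the variables in `s` occur, each of
them once. -/
noncomputable def listSpan (s : List X) : Submodule K (DiffPoly K X) :=
  Submodule.span K (Set.range (listMon K s))

/-- The sum of the orders of all derivatives of the variable `i` in a differential monomial. -/
noncomputable def diffOrder (M : X × ℕ →₀ ℕ) (i : X) : ℕ :=
  open Classical in ((Finsupp.toMultiset M).map fun p => if p.1 = i then p.2 else 0).sum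

namespace MultilinearVariety

variable (V : MultilinearVariety K) {m : BilinOps K Unit A} (hm : V.algebras A m)
  (d : A →ₗ[K] A) (a : X → A)

/-- The evaluation of `p ⊗ M`, where `p` is an element of the free algebra and `M` is a differential
monomial: every variable in `p` is replaced by its derivative of the order prescribed by `M`. -/
noncomputable def tensorEval : V.algebras.Free X ⊗[K] DiffPoly K X →ₗ[K] A :=
  TensorProduct.lift ((MvPolynomial.basisMonomials (X × ℕ) K).constr K fun M =>
    V.algebras.evalFree hm fun i => (d ^ diffOrder M i) (a i)).flip

theorem tensorEval_listMon (v : Mon Unit X) (hv : v.letters.Nodup) (k : X → ℕ) :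
    V.tensorEval hm d a (V.algebras.mk v ⊗ₜ listMon K v.letters k) =
      v.eval m fun i => (d ^ k i) (a i) := by
  classical
  have h : listMon K v.letters k =
      diffMon ((v.letters : Multiset X).map fun i => (i, k i)) := by
    simp [listMon, diffMon, Function.comp_def]
  rw [h, diffMon_eq_monomial, ← congrFun (MvPolynomial.coe_basisMonomials (X × ℕ) K), tensorEval,
    TensorProduct.lift.tmul, LinearMap.flip_apply, Module.Basis.constr_basis,
    AlgClass.evalFree_mk]
  refine Mon.eval_congr m v fun i hi => ?_
  have h2 : diffOrder (Multiset.toFinsupp ((v.letters : Multiset X).map fun i => (i, k i))) i =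
      k i := by
    rw [diffOrder, Multiset.toFinsupp_toMultiset, Multiset.map_map, Multiset.map_coe,
      Multiset.sum_coe]
    simp only [Function.comp_def]
    rw [← List.sum_toFinset _ hv]
    simp [hi]
  rw [h2]

theorem tensorEval_diffDer (hd : IsDer m d) (v : Mon Unit X) (hv : v.letters.Nodup)
    {p : DiffPoly K X} (hp : p ∈ listSpan K v.letters) :
    diffDer K X p ∈ listSpan K v.letters ∧
    V.tensorEval hm d a (V.algebras.mk v ⊗ₜ diffDer K X p) =
      d (V.tensorEval hm d a (V.algebras.mk v ⊗ₜ p)) := by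
  classical
  induction hp using Submodule.span_induction with
  | zero => simp
  | add p q _ _ h h' =>
    simp only [map_add, TensorProduct.tmul_add]
    exact ⟨add_mem h.1 h'.1, by rw [h.2, h'.2]⟩
  | smul c p _ h =>
    simp only [map_smul, Derivation.map_smul, TensorProduct.tmul_smul]
    exact ⟨Submodule.smul_mem _ _ h.1, by rw [h.2]⟩
  | mem p hp =>
    obtain ⟨k, rfl⟩ := hp
    rw [diffDer_listMon _ hv, tensorEval_listMon V hm d a v hv, hd.map_eval a v hv]
    refine ⟨list_sum_mem fun x hx => ?_, ?_⟩
    · obtain ⟨j, _, rfl⟩ := List.mem_map.1 hx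
      exact Submodule.subset_span ⟨_, rfl⟩
    · change ((V.tensorEval hm d a) ∘ₗ TensorProduct.mk K _ _ (V.algebras.mk v)) _ = _
      rw [map_list_sum, List.map_map]
      refine congrArg List.sum (List.map_congr_left fun j _ => ?_)
      exact tensorEval_listMon V hm d a v hv _

theorem tensorEval_mul (v w : Mon Unit X) (h : (v.letters ++ w.letters).Nodup)
    {p q : DiffPoly K X} (hp : p ∈ listSpan K v.letters) (hq : q ∈ listSpan K w.letters) :
    p * q ∈ listSpan K (v.letters ++ w.letters) ∧
    V.tensorEval hm d a (V.algebras.mk (Mon.mul () v w) ⊗ₜ (p * q)) =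
      m () (V.tensorEval hm d a (V.algebras.mk v ⊗ₜ p))
        (V.tensorEval hm d a (V.algebras.mk w ⊗ₜ q)) := by
  classical
  induction hp using Submodule.span_induction with
  | zero => simp
  | add p p' _ _ h h' =>
    simp only [add_mul, map_add, TensorProduct.tmul_add, LinearMap.add_apply]
    exact ⟨add_mem h.1 h'.1, by rw [h.2, h'.2]⟩
  | smul c p _ h =>
    simp only [smul_mul_assoc, map_smul, TensorProduct.tmul_smul, LinearMap.smul_apply]
    exact ⟨Submodule.smul_mem _ _ h.1, by rw [h.2]⟩
  | mem p hp =>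
    obtain ⟨k, rfl⟩ := hp
    induction hq using Submodule.span_induction with
    | zero => simp
    | add p p' _ _ h h' =>
      simp only [mul_add, map_add, TensorProduct.tmul_add]
      exact ⟨add_mem h.1 h'.1, by rw [h.2, h'.2]⟩
    | smul c p _ h =>
      simp only [mul_smul_comm, map_smul, TensorProduct.tmul_smul]
      exact ⟨Submodule.smul_mem _ _ h.1, by rw [h.2]⟩
    | mem q hq =>
      obtain ⟨k', rfl⟩ := hq
      have hn := List.nodup_append.1 h
      let κ : X → ℕ := fun i => if i ∈ v.letters then k i else k' i
      have h1 : ∀ i ∈ v.letters, k i = κ i := fun i hi => (if_pos hi).symm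
      have h2 : ∀ i ∈ w.letters, k' i = κ i :=
        fun i hi => (if_neg fun hi' => hn.2.2 i hi' i hi rfl).symm
      have e : listMon K v.letters k * listMon K w.letters k' =
          listMon K (v.letters ++ w.letters) κ := by
        rw [listMon_congr h1, listMon_congr h2]
        simp [listMon]
      rw [e]
      refine ⟨Submodule.subset_span ⟨_, rfl⟩, ?_⟩
      rw [tensorEval_listMon V hm d a v hn.1, tensorEval_listMon V hm d a w hn.2.1]
      refine (tensorEval_listMon V hm d a (Mon.mul () v w) h κ).trans ?_
      rw [Mon.eval]
      congr 1
      · congr 1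
        exact Mon.eval_congr m v fun i hi => by rw [h1 i hi]
      · exact Mon.eval_congr m w fun i hi => by rw [h2 i hi]

/-- Monomials in `≺`, `≻` without repeated variables are evaluated on `A^(d)` through
the tensor product of the free algebra and the algebra of differential polynomials. -/
theorem tensorEval_toTensorDiff_mk (hd : IsDer m d) (w : Mon DOp X) (hw : w.letters.Nodup) :
    V.tensorEval hm d a (V.toTensorDiff X (V.derivedAlgebras.mk w)) =
      w.eval (derivedOps m d) a := by
  rw [toTensorDiff_mk]
  suffices h : (w.toNov.eval (diffOps K X) fun i => MvPolynomial.X (i, 0)) ∈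
      listSpan K w.forget.letters ∧ V.tensorEval hm d a (V.algebras.mk w.forget ⊗ₜ
        w.toNov.eval (diffOps K X) fun i => MvPolynomial.X (i, 0)) =
      w.eval (derivedOps m d) a from h.2
  induction w with
  | var x =>
    have h : (MvPolynomial.X (x, 0) : DiffPoly K X) = listMon K [x] 0 := by simp [listMon]
    simp only [Mon.toNov, Mon.eval, Mon.forget]
    rw [h]
    exact ⟨Submodule.subset_span ⟨_, rfl⟩,
      V.tensorEval_listMon hm d a (Mon.var x) (by simp [Mon.letters]) 0⟩
  | mul ω l r hl hr =>
    have hw' : (l.forget.letters ++ r.forget.letters).Nodup := by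
      rwa [Mon.letters_forget, Mon.letters_forget]
    have hn := List.nodup_append.1 hw'
    have hl := hl (by rw [← Mon.letters_forget]; exact hn.1)
    have hr := hr (by rw [← Mon.letters_forget]; exact hn.2.1)
    cases ω
    · have h1 := V.tensorEval_diffDer hm d a hd _ hn.2.1 hr.1
      have h2 := V.tensorEval_mul hm d a _ _ hw' hl.1 h1.1
      rw [h1.2, hl.2, hr.2] at h2
      exact h2
    · have h1 := V.tensorEval_diffDer hm d a hd _ hn.1 hl.1
      have h2 := V.tensorEval_mul hm d a _ _ hw' h1.1 hr.1
      rw [h1.2, hl.2, hr.2, mul_comm] at h2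
      exact h2

theorem toTensorDiff_injOn {p : V.derivedAlgebras.Free X}
    (hp : p ∈ V.derivedAlgebras.multilinearPart X) (h : V.toTensorDiff X p = 0) : p = 0 := by
  obtain ⟨f, hf, rfl⟩ := hp
  refine (Submodule.Quotient.mk_eq_zero _).2 (V.mem_derivedIdentities_iff.2 ?_)
  intro A _ _ m d hm hd a
  have key : V.tensorEval hm d a (V.toTensorDiff X ((V.derivedAlgebras.identities X).mkQ f)) =
      NAPoly.eval (derivedOps m d) a f := by
    refine NAPoly.multilinear_induction (p := fun f =>
      V.tensorEval hm d a (V.toTensorDiff X ((V.derivedAlgebras.identities X).mkQ f)) =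
        NAPoly.eval (derivedOps m d) a f) ?_ ?_ ?_ ?_ hf
    · intro w hw
      rw [NAPoly.eval_mon]
      exact V.tensorEval_toTensorDiff_mk hm d a hd w hw.1
    · simp
    · intro f g hf hg
      rw [map_add, map_add, map_add, hf, hg, map_add]
    · intro c f hf
      rw [map_smul, map_smul, map_smul, hf, map_smul]
  rw [← key, h, map_zero]

end MultilinearVariety

end DerivationEval

/-! ### The isomorphism of operads -/

namespace AlgClass

variable {K : Type u} [Field K] {Ω : Type} (C : AlgClass K Ω)

theorem op_hom_ext {I : Type} [Finite I] {B : Type u} [AddCommGroup B] [Module K B]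
    {f g : C.operad.Op I →ₗ[K] B} (h : ∀ w hw, f (C.opMon w hw) = g (C.opMon w hw)) : f = g := by
  refine LinearMap.ext fun p => ?_
  obtain ⟨p, hp⟩ := p
  suffices h : ∃ hp : p ∈ C.multilinearPart I, f ⟨p, hp⟩ = g ⟨p, hp⟩ from h.2
  refine C.multilinear_induction (p := fun p => ∃ hp, f ⟨p, hp⟩ = g ⟨p, hp⟩) ?_ ?_ ?_ ?_ hp
  · exact fun w hw => ⟨_, h w hw⟩
  · exact ⟨zero_mem _, f.map_zero.trans g.map_zero.symm⟩
  · rintro p q ⟨hp, hp'⟩ ⟨hq, hq'⟩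
    exact ⟨add_mem hp hq, (f.map_add ⟨p, hp⟩ ⟨q, hq⟩).trans
      ((congrArg₂ (· + ·) hp' hq').trans (g.map_add ⟨p, hp⟩ ⟨q, hq⟩).symm)⟩
  · rintro c p ⟨hp, hp'⟩
    exact ⟨Submodule.smul_mem _ c hp, (f.map_smul c ⟨p, hp⟩).trans
      ((congrArg (c • ·) hp').trans (g.map_smul c ⟨p, hp⟩).symm)⟩

end AlgClass

theorem Mon.letters_length_pos {Ω X : Type} (w : Mon Ω X) : 0 < w.letters.length := by
  induction w with
  | var x => simp [letters]
  | mul ω l r hl hr => simp only [letters, List.length_append]; omega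

theorem Mon.eq_var_of_length {Ω X : Type} (w : Mon Ω X) (h : w.letters.length = 1) :
    ∃ x, w = var x := by
  cases w with
  | var x => exact ⟨x, rfl⟩
  | mul ω l r =>
    have h1 := l.letters_length_pos
    have h2 := r.letters_length_pos
    simp only [letters, List.length_append] at h
    omega

theorem Mon.IsMultilinear.eq_mul {Ω : Type} {w : Mon Ω (Fin 2)} (hw : w.IsMultilinear) :
    ∃ ω i j, i ≠ j ∧ w = mul ω (var i) (var j) := by
  have hlen : w.letters.length = 2 := by
    have h : w.letters.toFinset = Finset.univ := by
      ext x
      simp [hw.2 x]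
    rw [← List.toFinset_card_of_nodup hw.1, h]
    rfl
  cases w with
  | var x => simp [letters] at hlen
  | mul ω l r =>
    have h1 := l.letters_length_pos
    have h2 := r.letters_length_pos
    simp only [letters, List.length_append] at hlen
    obtain ⟨i, rfl⟩ := l.eq_var_of_length (by omega)
    obtain ⟨j, rfl⟩ := r.eq_var_of_length (by omega)
    refine ⟨ω, i, j, ?_, rfl⟩
    have := hw.1
    simpa [letters] using this

namespace MultilinearVariety

variable {K : Type u} [Field K] (V : MultilinearVariety K)

/-- The Hadamard product of the operad of the variety with the operad of Novikov algebras. -/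
noncomputable abbrev hadamardNov : SymOperad K := V.operad.hadamard (novikov K).operad

/-- The embedding of `Var(I) ⊗ Nov(I)` into the tensor product of the free algebra with the algebra
of differential polynomials. -/
noncomputable def hadamardToTensorDiff (I : Type) [Finite I] :
    V.hadamardNov.Op I →ₗ[K] V.algebras.Free I ⊗[K] DiffPoly K I :=
  TensorProduct.map (V.algebras.multilinearPart I).subtype
    (novToDiff K I ∘ₗ ((novikov K).algebras.multilinearPart I).subtype)

theorem hadamardToTensorDiff_injective (I : Type) [Finite I] :
    Function.Injective (V.hadamardToTensorDiff I) :=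
  TensorProduct.map_injective_of_flat_flat _ _ (Submodule.subtype_injective _)
    ((novToDiff_injective I).comp (Submodule.subtype_injective _))

theorem hadamardToTensorDiff_tmul {I : Type} [Finite I] (p : V.operad.Op I)
    (q : (novikov K).operad.Op I) : V.hadamardToTensorDiff I (p ⊗ₜ q) =
      p.1 ⊗ₜ novToDiff K I q.1 := rfl

/-- The image of a monomial in `≺`, `≻` in `Var(I) ⊗ Nov(I)`. -/
noncomputable def hadamardMon {I : Type} [Finite I] (w : Mon DOp I) (hw : w.IsMultilinear) :
    V.hadamardNov.Op I :=
  V.algebras.opMon w.forget hw.forget ⊗ₜ[K] (novikov K).algebras.opMon w.toNov hw.toNov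

theorem hadamardToTensorDiff_mon {I : Type} [Finite I] (w : Mon DOp I) (hw : w.IsMultilinear) :
    V.hadamardToTensorDiff I (V.hadamardMon w hw) =
      V.toTensorDiff I (V.derivedAlgebras.mk w) :=
  (V.toTensorDiff_mk' w).symm

theorem toTensorDiff_mem_range {I : Type} [Finite I] (p : V.derivedAlgebras.multilinearPart I) :
    V.toTensorDiff I p ∈ LinearMap.range (V.hadamardToTensorDiff I) := by
  refine V.derivedAlgebras.multilinear_induction (p := fun p =>
    V.toTensorDiff I p ∈ LinearMap.range (V.hadamardToTensorDiff I)) ?_ ?_ ?_ ?_ p.2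
  · exact fun w hw => ⟨_, V.hadamardToTensorDiff_mon w hw⟩
  · simp
  · intro p q hp hq
    rw [map_add]
    exact add_mem hp hq
  · intro c p hp
    rw [map_smul]
    exact Submodule.smul_mem _ c hp

/-- The linear map from the operad of derived identities to the Hadamard product. -/
noncomputable def toHadamard (I : Type) [Finite I] :
    V.derivedOperad.Op I →ₗ[K] V.hadamardNov.Op I :=
  (LinearEquiv.ofInjective _ (V.hadamardToTensorDiff_injective I)).symm.toLinearMap ∘ₗ
    (V.toTensorDiff I ∘ₗ (V.derivedAlgebras.multilinearPart I).subtype).codRestrict _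
      V.toTensorDiff_mem_range

theorem hadamardToTensorDiff_toHadamard {I : Type} [Finite I] (p : V.derivedOperad.Op I) :
    V.hadamardToTensorDiff I (V.toHadamard I p) = V.toTensorDiff I p.1 :=
  congrArg Subtype.val ((LinearEquiv.ofInjective _
    (V.hadamardToTensorDiff_injective I)).apply_symm_apply ⟨_, V.toTensorDiff_mem_range p⟩)

theorem toHadamard_opMon {I : Type} [Finite I] (w : Mon DOp I) (hw : w.IsMultilinear) :
    V.toHadamard I (V.derivedAlgebras.opMon w hw) = V.hadamardMon w hw := by
  apply V.hadamardToTensorDiff_injective I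
  rw [hadamardToTensorDiff_toHadamard, hadamardToTensorDiff_mon]
  rfl

theorem toHadamard_injective (I : Type) [Finite I] : Function.Injective (V.toHadamard I) := by
  rw [← LinearMap.ker_eq_bot, LinearMap.ker_eq_bot']
  intro p hp
  refine Subtype.ext (V.toTensorDiff_injOn p.2 ?_)
  rw [← hadamardToTensorDiff_toHadamard, hp, map_zero]

theorem toHadamard_map {I J : Type} [Finite I] [Finite J] (e : I ≃ J)
    (p : V.derivedOperad.Op I) :
    V.toHadamard J (V.derivedOperad.map e p) = V.hadamardNov.map e (V.toHadamard I p) := by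
  suffices h : V.toHadamard J ∘ₗ V.derivedOperad.map e =
    V.hadamardNov.map e ∘ₗ V.toHadamard I from LinearMap.congr_fun h p
  refine AlgClass.op_hom_ext _ fun w hw => ?_
  rw [LinearMap.comp_apply, LinearMap.comp_apply, toHadamard_opMon, AlgClass.map_opMon,
    toHadamard_opMon]
  apply V.hadamardToTensorDiff_injective J
  change _ = V.hadamardToTensorDiff J
    (V.operad.map e (V.algebras.opMon w.forget hw.forget) ⊗ₜ[K]
      (novikov K).operad.map e ((novikov K).algebras.opMon w.toNov hw.toNov))
  rw [AlgClass.map_opMon, AlgClass.map_opMon, hadamardToTensorDiff_mon, toTensorDiff_mk',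
    hadamardToTensorDiff_tmul, Mon.map, Mon.forget_bind, Mon.toNov_bind]
  rfl

theorem toHadamard_comp {I J : Type} [Finite I] [Finite J] (p : V.derivedOperad.Op (Option I))
    (q : V.derivedOperad.Op J) : V.toHadamard (I ⊕ J) (V.derivedOperad.comp p q) =
      V.hadamardNov.comp (V.toHadamard (Option I) p) (V.toHadamard J q) := by
  suffices h : V.derivedOperad.comp.compr₂ (V.toHadamard (I ⊕ J)) =
      V.hadamardNov.comp.compl₁₂ (V.toHadamard (Option I)) (V.toHadamard J) from
    LinearMap.congr_fun₂ h p q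
  refine AlgClass.op_hom_ext _ fun w hw => AlgClass.op_hom_ext _ fun v hv => ?_
  rw [LinearMap.compr₂_apply, LinearMap.compl₁₂_apply, toHadamard_opMon, toHadamard_opMon]
  apply V.hadamardToTensorDiff_injective
  rw [hadamardToTensorDiff_toHadamard]
  change V.toTensorDiff (I ⊕ J)
      (V.derivedAlgebras.insert (V.derivedAlgebras.mk w) (V.derivedAlgebras.mk v)) =
    V.algebras.insert (V.algebras.mk w.forget) (V.algebras.mk v.forget) ⊗ₜ novToDiff K (I ⊕ J)
      ((novikov K).algebras.insert ((novikov K).algebras.mk w.toNov)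
        ((novikov K).algebras.mk v.toNov))
  rw [AlgClass.insert_mk, AlgClass.insert_mk, AlgClass.insert_mk, toTensorDiff_mk',
    Mon.forget_bind, Mon.toNov_bind]
  congr 3
  · funext o
    cases o
    · exact Mon.forget_bind _ v
    · rfl
  · congr 1
    funext o
    cases o
    · exact Mon.toNov_bind _ v
    · rfl

theorem toHadamard_one : V.toHadamard Unit V.derivedOperad.one = V.hadamardNov.one :=
  V.toHadamard_opMon (Mon.var ()) (by simp [Mon.IsMultilinear, Mon.letters])

theorem toHadamard_mem_of_sub (S : V.hadamardNov.Sub) (hS : S.carrier (Fin 2) = ⊤) {I : Type}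
    [Finite I] (p : V.derivedOperad.Op I) : V.toHadamard I p ∈ S.carrier I := by
  let S' : V.derivedOperad.Sub :=
    { carrier := fun I _ => (S.carrier I).comap (V.toHadamard I)
      map_mem := fun e p hp => by
        rw [Submodule.mem_comap, toHadamard_map]
        exact S.map_mem e hp
      one_mem := by
        rw [Submodule.mem_comap, toHadamard_one]
        exact S.one_mem
      comp_mem := fun {_ _ _ _ p q} hp hq => by
        rw [Submodule.mem_comap, toHadamard_comp]
        exact S.comp_mem hp hq }
  refine AlgClass.sub_eq_top V.derivedAlgebras S' (fun ω => ?_) p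
  change _ ∈ S.carrier (Fin 2)
  rw [hS]
  trivial

theorem toHadamard_fin_two_surjective : LinearMap.range (V.toHadamard (Fin 2)) = ⊤ := by
  have key : (TensorProduct.mk K (V.operad.Op (Fin 2)) ((novikov K).operad.Op (Fin 2))).compr₂
      (LinearMap.range (V.toHadamard (Fin 2))).mkQ = 0 := by
    refine AlgClass.op_hom_ext _ fun v hv => AlgClass.op_hom_ext _ fun w hw => ?_
    refine (Submodule.Quotient.mk_eq_zero _).2 ?_
    obtain ⟨_, i, j, hij, rfl⟩ := hv.eq_mul
    obtain ⟨_, k, l, hkl, rfl⟩ := hw.eq_mul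
    have hm : ∀ ω : DOp, (Mon.mul ω (Mon.var i) (Mon.var j)).IsMultilinear :=
      fun ω => ⟨hv.1, hv.2⟩
    obtain ⟨rfl, rfl⟩ | ⟨rfl, rfl⟩ : (k = i ∧ l = j) ∨ (k = j ∧ l = i) := by omega
    · exact ⟨_, V.toHadamard_opMon _ (hm DOp.prec)⟩
    · exact ⟨_, V.toHadamard_opMon _ (hm DOp.succ)⟩
  refine Submodule.eq_top_iff'.2 fun p => ?_
  induction p using TensorProduct.induction_on with
  | zero => exact zero_mem _
  | tmul p q => exact (Submodule.Quotient.mk_eq_zero _).1 (LinearMap.congr_fun₂ key p q)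
  | add p q hp hq => exact add_mem hp hq

/-- The image of the operad of derived identities in the Hadamard product. -/
noncomputable def hadamardRange : V.hadamardNov.Sub where
  carrier I _ := LinearMap.range (V.toHadamard I)
  map_mem e _ hp := by
    obtain ⟨p, rfl⟩ := hp
    exact ⟨_, V.toHadamard_map e p⟩
  one_mem := ⟨_, V.toHadamard_one⟩
  comp_mem hp hq := by
    obtain ⟨p, rfl⟩ := hp
    obtain ⟨q, rfl⟩ := hq
    exact ⟨_, V.toHadamard_comp p q⟩

theorem toHadamard_mem {I : Type} [Finite I] (p : V.derivedOperad.Op I) :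
    V.toHadamard I p ∈ V.hadamardNov.binary.carrier I := by
  simp only [SymOperad.binary, Submodule.mem_iInf]
  exact fun S hS => V.toHadamard_mem_of_sub S hS p

/-- The operad of derived identities is isomorphic to `Var ∘ Nov`. -/
noncomputable def derivedIso : V.derivedOperad.Iso V.whiteNov where
  equiv I _ := LinearEquiv.ofBijective ((V.toHadamard I).codRestrict _ V.toHadamard_mem) <| by
    refine ⟨fun p q h => V.toHadamard_injective I (congrArg Subtype.val h), fun p => ?_⟩
    obtain ⟨p, hp⟩ := p
    simp only [SymOperad.binary, Submodule.mem_iInf] at hp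
    obtain ⟨q, hq⟩ := hp V.hadamardRange V.toHadamard_fin_two_surjective
    exact ⟨q, Subtype.ext hq⟩
  equiv_map e p := Subtype.ext (V.toHadamard_map e p)
  equiv_one := Subtype.ext V.toHadamard_one
  equiv_comp p q := Subtype.ext (V.toHadamard_comp p q)

theorem derivedIso_binaryOp (ω : DOp) :
    V.derivedIso.equiv (Fin 2) (V.derivedAlgebras.binaryOp ω 1) = V.whiteOp ω := by
  refine Subtype.ext ?_
  refine (V.toHadamard_opMon (Mon.mul ω (Mon.var 0) (Mon.var 1)) ?_).trans ?_
  · exact ⟨by simp [Mon.letters], fun i => by fin_cases i <;> simp [Mon.letters]⟩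
  · cases ω <;> rfl

end MultilinearVariety

/-! ### Algebras over isomorphic operads -/

namespace SymOperad.Iso

variable {K : Type u} [Field K] {P Q : SymOperad K}

/-- The inverse isomorphism. -/
def symm (φ : P.Iso Q) : Q.Iso P where
  equiv I _ := (φ.equiv I).symm
  equiv_map {I J} _ _ e p := by
    rw [LinearEquiv.symm_apply_eq, φ.equiv_map, LinearEquiv.apply_symm_apply]
  equiv_one := by rw [LinearEquiv.symm_apply_eq, φ.equiv_one]
  equiv_comp p q := by
    rw [LinearEquiv.symm_apply_eq, φ.equiv_comp, LinearEquiv.apply_symm_apply,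
      LinearEquiv.apply_symm_apply]

/-- The structure of an algebra pulled back along an isomorphism of operads. -/
def pullback (φ : P.Iso Q) {B : Type u} [AddCommGroup B] [Module K B] (α : Q.Algebra B) :
    P.Algebra B where
  act {I} _ := α.act ∘ₗ (φ.equiv I).toLinearMap
  act_map e p b := by
    change α.act (φ.equiv _ _) b = _
    rw [φ.equiv_map, α.act_map]
    rfl
  act_one b := by
    change α.act (φ.equiv _ _) b = _
    rw [φ.equiv_one, α.act_one]
  act_comp p q b := by
    change α.act (φ.equiv _ _) b = _
    rw [φ.equiv_comp, α.act_comp]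
    rfl

theorem pullback_bilin (φ : P.Iso Q) {B : Type u} [AddCommGroup B] [Module K B]
    (α : Q.Algebra B) (p : P.Op (Fin 2)) :
    (φ.pullback α).bilin p = α.bilin (φ.equiv (Fin 2) p) := rfl

end SymOperad.Iso

theorem MultilinearVariety.holdsOnWhiteNov_iff {K : Type u} [Field K] (V : MultilinearVariety K)
    {I : Type} [Finite I] {f : NAPoly K DOp I} (hf : f ∈ NAPoly.multilinear K DOp I) :
    V.HoldsOnWhiteNov f ↔ V.IsDerivedIdentity f := by
  constructor
  · intro h A _ _ mul d hmul hd a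
    let hm : V.derivedAlgebras A (derivedOps mul d) := ⟨mul, d, hmul, hd, rfl⟩
    have e : (fun ω => (V.derivedIso.symm.pullback
        (V.derivedAlgebras.operadAlgebra hm)).bilin (V.whiteOp ω)) = derivedOps mul d := by
      funext ω
      rw [SymOperad.Iso.pullback_bilin, ← V.derivedAlgebras.operadAlgebra_bilin hm ω,
        ← V.derivedIso_binaryOp ω]
      exact congrArg _ ((V.derivedIso.equiv (Fin 2)).symm_apply_apply _)
    rw [← e]
    exact h A _ a
  · intro h B _ _ α b
    have e : (fun ω => α.bilin (V.whiteOp ω)) = fun ω =>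
        (V.derivedIso.pullback α).bilin (V.derivedAlgebras.binaryOp ω 1) := by
      funext ω
      rw [SymOperad.Iso.pullback_bilin, derivedIso_binaryOp]
    rw [e, ← V.derivedAlgebras.act_mkQ (V.derivedIso.pullback α) hf b]
    have h0 : (⟨(V.derivedAlgebras.identities I).mkQ f, ⟨f, hf, rfl⟩⟩ : V.derivedOperad.Op I) =
        (0 : V.derivedOperad.Op I) := Subtype.ext ((Submodule.Quotient.mk_eq_zero _).2 (V.mem_derivedIdentities_iff.2 h))
    rw [h0]
    exact congrFun (congrArg DFunLike.coe (map_zero (V.derivedIso.pullback α).act)) b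

theorem mainTheorem4 {K : Type u} [Field K] (V : MultilinearVariety K) :
    (∀ (n : ℕ) (f : NAPoly K DOp (Fin n)), f ∈ NAPoly.multilinear K DOp (Fin n) →
      (V.HoldsOnWhiteNov f ↔ V.IsDerivedIdentity f)) ∧
    ∃ φ : V.derivedOperad.Iso V.whiteNov,
      ∀ ω : DOp, φ.equiv (Fin 2) (V.derivedAlgebras.binaryOp ω 1) = V.whiteOp ω :=
  ⟨fun _ _ hf => V.holdsOnWhiteNov_iff hf, V.derivedIso, V.derivedIso_binaryOp⟩
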